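/- **Setting.** Let $k$ be a unital ring, not necessarily commutative, that contains $\mathbb Q$ (as a central subring). A *para-precyclic $k$-module* is a sequence of left $k$-modules $C_m$, $m\ge 0$, with $k$-linear maps $d_j:C_m\to C_{m-1}$ ($0\le j\le m$, $m\geq 1$) and invertible $k$-linear maps $t:C_m\to C_m$ such that $d_id_j=d_{j-1}d_i$ for $i\le j-1$, $td_i=d_{i+1}t$ for $0\le i\le m-1$, and $d_m=d_0t$ on $C_m$. Put $T=t^{m+1}$ on $C_m$; the module is *precyclic* when $T=1$. On $C_m$ set $$b=\sum_{j=0}^m(-1)^jd_j,\qquad b'=\sum_{j=0}^{m-1}(-1)^jd_j,\qquad \tau=(-1)^mt,\qquad N=\sum_{j=0}^m\tau^j$$ (with $b=b'=0$ on $C_0$). The module is *$H$-unital* if it is given with $k$-linear maps $s:C_m\to C_{m+1}$ such that $b's+sb'=1$ and $sT=Ts$. We then put $s'=sb's$ and $B=(1-\tau)s'N$. On $C_m$ put $$\hat N x=\tfrac1{m+1}Nx,\qquad \hat Dx=\tfrac1{m+1}\sum_{j=0}^m(m-j)\tau^jx,\qquad \hat b'x=\tfrac1m\,b'x\ \ (m\ge1),\qquad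 S_0=-\hat b'\hat Db\hat N:C_{m+2}\to C_m .$$ *Cochains* (all of them right $k$-modules). Let $C_T^m=\{\varphi\in\mathrm{Hom}_k(C_m,k):\varphi\circ T=\varphi\}$ and $C_\lambda^m=\{\varphi\in\mathrm{Hom}_k(C_m,k):\varphi\circ\tau=\varphi\}\subseteq C_T^m$. (If $C$ is precyclic, then $C_T^m=\mathrm{Hom}_k(C_m,k)$.) Composition with $b$ and with $B$ gives operators $b:C_T^m\to C_T^{m+1}$, $B:C_T^{m+1}\to C_T^{m}$ and $b:C_\lambda^m\to C_\lambda^{m+1}$, and composition with $S_0$ gives the periodicity operator, a cochain map $S:C_\lambda^m\to C_\lambda^{m+2}$. Define: * $C_{T,\natural}^m=C_T^m\oplus C_T^{m-2}\oplus\cdots$ with differential $b+B$; * $C_{T,\sharp}$, the $\mathbb Z/2$-graded complex with $C_{T,\sharp}^i=\bigoplus_{q\ge0}C_T^{2q+i}$ ($i=0,1$) and differential $b+B$; its cohomology is denoted by $HP^i(C_T)$; * $H_\lambda^m(C)$, the cohomology of $(C_\lambda^\bullet,b)$, and $\varinjlim_SH_\lambda^{2q+i}(C)=\bigl(\bigoplus_qH^{2q+i}_\lambda(C)\bigr)/\mathrm{ran}(1-S)$;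 * $C_{\lambda,\sharp}$, the $\mathbb Z/2$-graded complex with $C_{\lambda,\sharp}^i=\bigl(\bigoplus_{q\ge0}C_\lambda^{2q+i}\bigr)/\mathrm{ran}(1-S)$ and differential $b$; its cohomology is denoted by $H_{\lambda,\sharp}^i(C)$. Let $\bar\iota_\natural:C_\lambda^m\to C_{T,\natural}^m$, $\varphi\mapsto(\varphi,0,\dots)$, be the inclusion, and put $$\bar\nu_\natural(\varphi)=\sum_{m-2j\ge0}(-1)^j\varphi_{m-2j}\circ\bigl\{[1-(1-\tau)s'\hat Db](\hat b'\hat Db)^j\hat N\bigr\},\qquad \varphi=(\varphi_m,\varphi_{m-2},\dots)\in C_{T,\natural}^m,$$ $$\bar\nu_\sharp(\varphi)=\text{class of }\bigl(\varphi_{2q+i}\circ\{[1-(1-\tau)s'\hat Db]\hat N\}\bigr)_{q\ge0}\ \bmod\ \mathrm{ran}(1-S),\qquad \varphi=(\varphi_{2q+i})_{q\ge0}\in C_{T,\sharp}^i .$$ **Theorem.** Let $C$ be an $H$-unital para-precyclic $k$-module with $k\supset\mathbb Q$ (in particular, $C$ may be any $H$-unital precyclic $k$-module). (A) The maps $\bar\iota_\natural:C_\lambda^\bullet\to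 C_{T,\natural}^\bullet$ and $\bar\nu_\natural:C_{T,\natural}^\bullet\to C_\lambda^\bullet$ are cochain maps, $\bar\nu_\natural\bar\iota_\natural=1$, and $\bar\iota_\natural\bar\nu_\natural$ is cochain homotopic to the identity through right $k$-linear maps. In particular, for every $(b,B)$-cocycle $\varphi\in C_{T,\natural}^m$, the cyclic cochain $\bar\nu_\natural(\varphi)\in C_\lambda^m$ is a cocycle, and $\bar\iota_\natural\bar\nu_\natural(\varphi)$ is cohomologous to $\varphi$ in $C_{T,\natural}$. (B) The map $\bar\nu_\sharp:C_{T,\sharp}^\bullet\to C_{\lambda,\sharp}^\bullet$ is a cochain map and a quasi-isomorphism. Moreover, for $i\in\mathbb Z/2$: 1. there is a canonical isomorphism $\varinjlim_SH_\lambda^{2q+i}(C)\simeq H_{\lambda,\sharp}^i(C)$ of right $k$-modules, which sends the class of each cyclic cocycle of degree $m\equiv i$ to its class in $H^i_{\lambda,\sharp}(C)$; 2. Connes' map $\bar\iota_\sharp:\varinjlim_SH_\lambda^{2q+i}(C)\to HP^i(C_T)$, which sends the class of each cyclic cocycle of degree $m\equiv i$ to its class in $HP^i(C_T)$, is well defined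 and is an isomorphism of right $k$-modules; 3. in cohomology, $\bar\nu_\sharp\circ\bar\iota_\sharp$ is the canonical isomorphism of (1). Hence, under this canonical isomorphism, $\bar\nu_\sharp:HP^i(C_T)\to H_{\lambda,\sharp}^i(C)$ is the inverse of Connes' map. -/

import Mathlib

open scoped DirectSum

universe u v

/-- A para-precyclic `k`-module. `d m j` is the face `d_j` on `C_{m+1}`, `0 ≤ j ≤ m+1`, and
`t m` is the invertible operator `t` on `C_m`. -/
structure ParaPrecyclicModule (k : Type u) [Ring k] where
  X : ℕ → Type v
  [addCommGroup : ∀ m, AddCommGroup (X m)]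
  [module : ∀ m, Module k (X m)]
  d : ∀ m, Fin (m + 2) → (X (m + 1) →ₗ[k] X m)
  t : ∀ m, X m ≃ₗ[k] X m
  /-- `d_i d_j = d_{j-1} d_i` for `i ≤ j - 1` -/
  d_comp_d : ∀ (m : ℕ) (i j : Fin (m + 2)), i ≤ j →
    d m i ∘ₗ d (m + 1) j.succ = d m j ∘ₗ d (m + 1) i.castSucc
  /-- `t d_i = d_{i+1} t` on `C_{m+1}`, `0 ≤ i ≤ m` -/
  t_comp_d : ∀ (m : ℕ) (i : Fin (m + 1)),
    (t m).toLinearMap ∘ₗ d m i.castSucc = d m i.succ ∘ₗ (t (m + 1)).toLinearMap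
  /-- `d_{m+1} = d_0 t` on `C_{m+1}` -/
  d_last : ∀ m : ℕ, d m (Fin.last (m + 1)) = d m 0 ∘ₗ (t (m + 1)).toLinearMap

attribute [instance] ParaPrecyclicModule.addCommGroup ParaPrecyclicModule.module

namespace ParaPrecyclicModule

variable {k : Type u} [Ring k] (C : ParaPrecyclicModule.{u, v} k)

/-- The signed face `(-1)^j d_j` on `C_{m+1}` (zero for `j` out of range). -/
def sd (m j : ℕ) : C.X (m + 1) →ₗ[k] C.X m :=
  if h : j < m + 2 then (-1 : ℤ) ^ j • C.d m ⟨j, h⟩ else 0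

/-- The differential `b : C_{m+1} → C_m`. -/
def b (m : ℕ) : C.X (m + 1) →ₗ[k] C.X m := ∑ j ∈ Finset.range (m + 2), C.sd m j

/-- The differential `b' : C_{m+1} → C_m` of the bar complex. -/
def b' (m : ℕ) : C.X (m + 1) →ₗ[k] C.X m := ∑ j ∈ Finset.range (m + 1), C.sd m j

/-- `T = t^{m+1}` on `C_m`. -/
def T (m : ℕ) : C.X m →ₗ[k] C.X m := ((C.t m).toLinearMap : Module.End k (C.X m)) ^ (m + 1)

/-- A precyclic module is a para-precyclic module such that `T = 1`. -/
def IsPrecyclic : Prop := ∀ m, C.T m = LinearMap.id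

/-- `τ = (-1)^m t` on `C_m`. -/
def τ (m : ℕ) : C.X m →ₗ[k] C.X m := (-1 : ℤ) ^ m • (C.t m).toLinearMap

/-- `N = 1 + τ + ⋯ + τ^m` on `C_m`. -/
def N (m : ℕ) : C.X m →ₗ[k] C.X m :=
  ∑ j ∈ Finset.range (m + 1), (C.τ m : Module.End k (C.X m)) ^ j

section Rat

variable [Algebra ℚ k]

/-- Multiplication by a rational number. -/
def rat (q : ℚ) (m : ℕ) : C.X m →ₗ[k] C.X m where
  toFun x := algebraMap ℚ k q • x
  map_add' := smul_add _
  map_smul' a x := by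
    simp only [← mul_smul, RingHom.id_apply, Algebra.commutes]

/-- `N̂ x = N ((m+1)⁻¹ x)` on `C_m`. -/
def Nhat (m : ℕ) : C.X m →ₗ[k] C.X m := C.N m ∘ₗ C.rat ((m + 1 : ℚ)⁻¹) m

/-- `D̂ x = ∑_{0 ≤ j ≤ m} (m - j) τ^j ((m+1)⁻¹ x)` on `C_m`. -/
def Dhat (m : ℕ) : C.X m →ₗ[k] C.X m :=
  (∑ j ∈ Finset.range (m + 1), (m - j) • (C.τ m : Module.End k (C.X m)) ^ j) ∘ₗ
    C.rat ((m + 1 : ℚ)⁻¹) m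

/-- `b̂' x = (m+1)⁻¹ b' x` on `C_{m+1}`. -/
def bhat' (m : ℕ) : C.X (m + 1) →ₗ[k] C.X m := C.rat ((m + 1 : ℚ)⁻¹) m ∘ₗ C.b' m

/-- `b̂' D̂ b : C_{m+2} → C_m`. -/
def bDb (m : ℕ) : C.X (m + 2) →ₗ[k] C.X m := C.bhat' m ∘ₗ C.Dhat (m + 1) ∘ₗ C.b (m + 1)

/-- The operator `S₀ = - b̂' D̂ b N̂ : C_{m+2} → C_m` inducing the periodicity operator. -/
def S₀ (m : ℕ) : C.X (m + 2) →ₗ[k] C.X m := -(C.bDb m ∘ₗ C.Nhat (m + 2))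

/-- `b̂' D̂ b` as an operator `C_m → C_{m-2}` for every `m`; it is zero for `m = 0, 1`. -/
def bDbTot : ∀ m : ℕ, C.X m →ₗ[k] C.X (m - 2)
  | 0 => 0
  | 1 => 0
  | m + 2 => C.bDb m

/-- The iterate `(b̂' D̂ b)^j : C_m → C_{m-2j}`. -/
def bDbPow (m : ℕ) : ∀ j : ℕ, C.X m →ₗ[k] C.X (m - 2 * j)
  | 0 => LinearMap.id
  | j + 1 => C.bDbTot (m - 2 * j) ∘ₗ bDbPow m j

end Rat

/-! Basic identities. -/

lemma τ_sd {m j : ℕ} (h : j ≤ m) (x : C.X (m + 1)) :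
    C.τ m (C.sd m j x) = C.sd m (j + 1) (C.τ (m + 1) x) := by
  have h1 := LinearMap.congr_fun (C.t_comp_d m ⟨j, by omega⟩) x
  have h2 : (Fin.castSucc (⟨j, by omega⟩ : Fin (m + 1))) = ⟨j, by omega⟩ := rfl
  have h3 : (Fin.succ (⟨j, by omega⟩ : Fin (m + 1))) = ⟨j + 1, by omega⟩ := rfl
  rw [h2, h3] at h1
  simp only [LinearMap.comp_apply] at h1
  simp only [τ, sd, show j < m + 2 by omega, show j + 1 < m + 2 by omega, dif_pos,
    LinearMap.smul_apply, map_zsmul, h1, smul_smul]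
  congr 1
  ring

lemma sd_last (m : ℕ) (x : C.X (m + 1)) :
    C.sd m (m + 1) x = C.sd m 0 (C.τ (m + 1) x) := by
  have h1 := LinearMap.congr_fun (C.d_last m) x
  have h2 : Fin.last (m + 1) = ⟨m + 1, by omega⟩ := rfl
  rw [h2] at h1
  simp only [LinearMap.comp_apply] at h1
  simp only [τ, sd, show m + 1 < m + 2 by omega, show 0 < m + 2 by omega, dif_pos,
    LinearMap.smul_apply, map_zsmul, h1, pow_zero, one_smul]
  rfl

lemma τpow_sd {m i : ℕ} (a : ℕ) (h : i + a ≤ m + 1) (x : C.X (m + 1)) :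
    ((C.τ m : Module.End k (C.X m)) ^ a) (C.sd m i x) =
      C.sd m (i + a) (((C.τ (m + 1) : Module.End k (C.X (m + 1))) ^ a) x) := by
  induction a with
  | zero => rfl
  | succ a ih =>
    rw [pow_succ', pow_succ', Module.End.mul_apply, Module.End.mul_apply, ih (by omega),
      C.τ_sd (by omega)]
    rfl

lemma τpow_sd_wrap {m i : ℕ} (a c : ℕ) (hi : i ≤ m + 1) (hc : c ≤ m + 1)
    (h : i + a = m + 1 + c) (x : C.X (m + 1)) :
    ((C.τ m : Module.End k (C.X m)) ^ a) (C.sd m i x) =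
      C.sd m c (((C.τ (m + 1) : Module.End k (C.X (m + 1))) ^ (a + 1)) x) := by
  obtain ⟨e, rfl⟩ : ∃ e, a = c + e := ⟨a - c, by omega⟩
  rw [pow_add, Module.End.mul_apply, C.τpow_sd e (by omega), show i + e = m + 1 by omega, sd_last,
    C.τpow_sd c (by omega), zero_add, show c + e + 1 = c + (1 + e) by ring, pow_add, pow_add,
    pow_one]
  rfl

lemma T_eq (m : ℕ) (x : C.X m) :
    C.T m x = ((C.τ m : Module.End k (C.X m)) ^ (m + 1)) x := by
  have : (C.τ m : Module.End k (C.X m)) ^ (m + 1) = C.T m := by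
    rw [τ, T, smul_pow, ← pow_mul, Even.neg_one_pow (Nat.even_mul_succ_self m), one_smul]
  rw [this]

lemma T_sd (m : ℕ) {i : ℕ} (hi : i ≤ m + 1) (x : C.X (m + 1)) :
    C.T m (C.sd m i x) = C.sd m i (C.T (m + 1) x) := by
  rw [T_eq, T_eq, C.τpow_sd_wrap (m + 1) i hi hi (by ring)]

lemma T_b (m : ℕ) (x : C.X (m + 1)) : C.T m (C.b m x) = C.b m (C.T (m + 1) x) := by
  simp only [b, LinearMap.sum_apply, map_sum]
  exact Finset.sum_congr rfl fun i hi => C.T_sd m (by simp at hi; omega) x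

lemma T_b' (m : ℕ) (x : C.X (m + 1)) : C.T m (C.b' m x) = C.b' m (C.T (m + 1) x) := by
  simp only [b', LinearMap.sum_apply, map_sum]
  exact Finset.sum_congr rfl fun i hi => C.T_sd m (by simp at hi; omega) x

lemma T_τpow (m a : ℕ) (x : C.X m) :
    C.T m (((C.τ m : Module.End k (C.X m)) ^ a) x) =
      ((C.τ m : Module.End k (C.X m)) ^ a) (C.T m x) := by
  rw [T_eq, T_eq, ← Module.End.mul_apply, ← Module.End.mul_apply, ← pow_add, ← pow_add, add_comm]

lemma T_τ (m : ℕ) (x : C.X m) : C.T m (C.τ m x) = C.τ m (C.T m x) := by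
  simpa using C.T_τpow m 1 x

lemma T_N (m : ℕ) (x : C.X m) : C.T m (C.N m x) = C.N m (C.T m x) := by
  simp only [N, LinearMap.sum_apply, map_sum, T_τpow]

lemma b_sub_b' (m : ℕ) (x : C.X (m + 1)) : C.b m x = C.b' m x + C.sd m (m + 1) x := by
  simp only [b, b', LinearMap.sum_apply]
  rw [Finset.sum_range_succ]

/-- `b (1 - τ) = (1 - τ) b'` -/
lemma b_τ (m : ℕ) (x : C.X (m + 1)) :
    C.b m (x - C.τ (m + 1) x) = C.b' m x - C.τ m (C.b' m x) := by
  have h : C.τ m (C.b' m x) = ∑ j ∈ Finset.range (m + 1), C.sd m (j + 1) (C.τ (m + 1) x) := by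
    simp only [b', LinearMap.sum_apply, map_sum]
    exact Finset.sum_congr rfl fun j hj => C.τ_sd (by simp at hj; omega) x
  have h2 : C.b m (C.τ (m + 1) x) = C.τ m (C.b' m x) + C.sd m (m + 1) x := by
    rw [h, sd_last]
    simp only [b, LinearMap.sum_apply]
    rw [Finset.sum_range_succ' _ (m + 1)]
  rw [map_sub, h2, b_sub_b']
  abel

/-- `N b = b' N` -/
lemma N_b (m : ℕ) (x : C.X (m + 1)) : C.N m (C.b m x) = C.b' m (C.N (m + 1) x) := by
  simp only [N, b, b', LinearMap.sum_apply, map_sum]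
  rw [← Finset.sum_product', ← Finset.sum_product']
  refine Finset.sum_nbij' (fun p => if p.1 + p.2 ≤ m then (p.2, p.1 + p.2)
      else (p.2 + 1, p.1 + p.2 - (m + 1)))
    (fun q => if q.1 ≤ q.2 then (q.2 - q.1, q.1) else (q.2 + m + 2 - q.1, q.1 - 1)) ?_ ?_ ?_ ?_ ?_
  · rintro ⟨p, q⟩ h
    simp only [Finset.mem_product, Finset.mem_range] at h ⊢
    split_ifs <;> simp only <;> omega
  · rintro ⟨p, q⟩ h
    simp only [Finset.mem_product, Finset.mem_range] at h ⊢
    split_ifs <;> simp only <;> omega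
  · rintro ⟨p, q⟩ h
    simp only [Finset.mem_product, Finset.mem_range] at h
    by_cases hpq : p + q ≤ m
    · simp only [hpq, if_true, show q ≤ p + q by omega, Prod.mk.injEq, and_true]; omega
    · simp only [hpq, if_false, show ¬ q + 1 ≤ p + q - (m + 1) by omega, Prod.mk.injEq]; omega
  · rintro ⟨p, q⟩ h
    simp only [Finset.mem_product, Finset.mem_range] at h
    by_cases hpq : p ≤ q
    · simp only [hpq, if_true, show q - p + p ≤ m by omega, Prod.mk.injEq, true_and]; omega
    · simp only [hpq, if_false, show ¬ q + m + 2 - p + (p - 1) ≤ m by omega, Prod.mk.injEq]; omega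
  · rintro ⟨p, q⟩ h
    simp only [Finset.mem_product, Finset.mem_range] at h
    by_cases hpq : p + q ≤ m
    · simp only [hpq, if_true]
      exact C.τpow_sd q (by omega) x
    · simp only [hpq, if_false]
      exact C.τpow_sd_wrap q (p + q - (m + 1)) (by omega) (by omega) (by omega) x

lemma sum_sign_zero {M : Type*} [AddCommGroup M] (a : ℕ → ℕ → M) (n : ℕ)
    (h : ∀ i j, i ≤ j → j < n → a i (j + 1) = -a j i) :
    ∑ i ∈ Finset.range n, ∑ j ∈ Finset.range (n + 1), a i j = 0 := by
  induction n with
  | zero => simp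
  | succ n ih =>
    have h1 := ih fun i j hij hj => h i j hij (by omega)
    rw [Finset.sum_range_succ]
    simp_rw [Finset.sum_range_succ _ (n + 1)]
    rw [Finset.sum_add_distrib, h1, zero_add, add_comm (∑ x ∈ Finset.range (n + 1), a n x),
      ← add_assoc, ← Finset.sum_range_succ (fun x => a x (n + 1)), ← Finset.sum_add_distrib]
    exact Finset.sum_eq_zero fun i hi => by
      rw [h i n (by simp at hi; omega) (by omega)]; simp

lemma sd_sd (m : ℕ) {i j : ℕ} (hij : i ≤ j) (hj : j ≤ m + 1) (x : C.X (m + 2)) :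
    C.sd m i (C.sd (m + 1) (j + 1) x) = -C.sd m j (C.sd (m + 1) i x) := by
  have h1 := LinearMap.congr_fun (C.d_comp_d m ⟨i, by omega⟩ ⟨j, by omega⟩ hij) x
  have h2 : (Fin.castSucc (⟨i, by omega⟩ : Fin (m + 2))) = ⟨i, by omega⟩ := rfl
  have h3 : (Fin.succ (⟨j, by omega⟩ : Fin (m + 2))) = ⟨j + 1, by omega⟩ := rfl
  rw [h2, h3] at h1
  simp only [LinearMap.comp_apply] at h1
  simp only [sd, show j < m + 2 by omega, show j + 1 < m + 1 + 2 by omega,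
    show i < m + 2 by omega, show i < m + 1 + 2 by omega, dif_pos,
    LinearMap.smul_apply, map_zsmul, h1, smul_smul, ← neg_smul]
  congr 1
  ring

/-- `b² = 0` -/
lemma b_b (m : ℕ) (x : C.X (m + 2)) : C.b m (C.b (m + 1) x) = 0 := by
  simp only [b, LinearMap.sum_apply, map_sum]
  rw [Finset.sum_comm]
  exact sum_sign_zero (fun i j => C.sd m i (C.sd (m + 1) j x)) (m + 2)
    fun i j hij hj => C.sd_sd m hij (by omega) x

/-- `b'² = 0` -/
lemma b'_b' (m : ℕ) (x : C.X (m + 2)) : C.b' m (C.b' (m + 1) x) = 0 := by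
  simp only [b', LinearMap.sum_apply, map_sum]
  rw [Finset.sum_comm]
  exact sum_sign_zero (fun i j => C.sd m i (C.sd (m + 1) j x)) (m + 1)
    fun i j hij hj => C.sd_sd m hij (by omega) x

/-- `(1 - τ) N = 1 - T` -/
lemma N_sub_τ_N (m : ℕ) (x : C.X m) : C.N m x - C.τ m (C.N m x) = x - C.T m x := by
  have h := LinearMap.congr_fun (mul_neg_geom_sum (C.τ m : Module.End k (C.X m)) (m + 1)) x
  rw [T_eq]
  exact h

/-- `N (1 - τ) = 1 - T` -/
lemma N_τ (m : ℕ) (x : C.X m) : C.N m (x - C.τ m x) = x - C.T m x := by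
  have h := LinearMap.congr_fun (geom_sum_mul_neg (C.τ m : Module.End k (C.X m)) (m + 1)) x
  rw [T_eq]
  exact h

lemma cyclic_τpow {m : ℕ} {φ : C.X m →ₗ[k] k} (hφ : ∀ x, φ (C.τ m x) = φ x) (j : ℕ)
    (x : C.X m) : φ (((C.τ m : Module.End k (C.X m)) ^ j) x) = φ x := by
  induction j with
  | zero => rfl
  | succ j ih => rw [pow_succ', Module.End.mul_apply, hφ, ih]

lemma cyclic_T {m : ℕ} {φ : C.X m →ₗ[k] k} (hφ : ∀ x, φ (C.τ m x) = φ x)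
    (x : C.X m) : φ (C.T m x) = φ x := by
  rw [T_eq, C.cyclic_τpow hφ]

lemma cyclic_N {m : ℕ} {φ : C.X m →ₗ[k] k} (hφ : ∀ x, φ (C.τ m x) = φ x)
    (x : C.X m) : φ (C.N m x) = (m + 1) • φ x := by
  simp only [N, LinearMap.sum_apply, map_sum, C.cyclic_τpow hφ, Finset.sum_const,
    Finset.card_range]

lemma cyclic_b {m : ℕ} {φ : C.X m →ₗ[k] k} (hφ : ∀ x, φ (C.τ m x) = φ x)
    (x : C.X (m + 1)) : φ (C.b m (C.τ (m + 1) x)) = φ (C.b m x) := by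
  have h := congrArg φ (C.b_τ m x)
  rw [map_sub, map_sub, map_sub, hφ, sub_self, sub_eq_zero] at h
  exact h.symm

section Rat

variable [Algebra ℚ k]

lemma rat_map {m n : ℕ} (f : C.X m →ₗ[k] C.X n) (q : ℚ) (x : C.X m) :
    f (C.rat q m x) = C.rat q n (f x) := map_smul f _ _

lemma rat_rat {m : ℕ} (p q : ℚ) (x : C.X m) : C.rat p m (C.rat q m x) = C.rat (p * q) m x := by
  simp only [rat, LinearMap.coe_mk, AddHom.coe_mk, smul_smul, map_mul]

lemma rat_one {m : ℕ} (x : C.X m) : C.rat 1 m x = x := by simp [rat]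

lemma rat_natCast {m : ℕ} (n : ℕ) (x : C.X m) : C.rat n m x = n • x := by
  simp [rat, Nat.cast_smul_eq_nsmul]

lemma rat_inv_cancel {m : ℕ} (n : ℕ) (x : C.X m) :
    (n + 1) • C.rat ((n + 1 : ℚ)⁻¹) m x = x := by
  have h : (n + 1 : ℚ) ≠ 0 := by positivity
  rw [← rat_natCast, rat_rat]
  push_cast
  rw [mul_inv_cancel₀ h, rat_one]

lemma geom_D {R : Type*} [Ring R] (X : R) (m : ℕ) :
    ∑ j ∈ Finset.range (m + 1), X ^ j +
      (1 - X) * ∑ j ∈ Finset.range (m + 1), (m - j) • X ^ j = (m + 1) • (1 : R) := by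
  induction m with
  | zero => simp
  | succ m ih =>
    have h : ∑ j ∈ Finset.range (m + 1 + 1), (m + 1 - j) • X ^ j =
        ∑ j ∈ Finset.range (m + 1), (m - j) • X ^ j + ∑ j ∈ Finset.range (m + 1), X ^ j := by
      rw [Finset.sum_range_succ, Nat.sub_self, zero_smul, add_zero, ← Finset.sum_add_distrib]
      refine Finset.sum_congr rfl fun j hj => ?_
      rw [show m + 1 - j = (m - j) + 1 by simp at hj; omega, add_smul, one_smul]
    rw [h, mul_add, mul_neg_geom_sum, Finset.sum_range_succ _ (m + 1), add_smul (m + 1) 1, ← ih]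
    simp only [one_smul]
    abel

/-- `N̂ + (1 - τ) D̂ = 1` -/
lemma Nhat_add (m : ℕ) (x : C.X m) :
    C.Nhat m x + (C.Dhat m x - C.τ m (C.Dhat m x)) = x := by
  have h := LinearMap.congr_fun (geom_D (C.τ m : Module.End k (C.X m)) m)
    (C.rat ((m + 1 : ℚ)⁻¹) m x)
  have h2 := C.rat_inv_cancel m x
  rw [LinearMap.smul_apply, Module.End.one_apply, h2] at h
  exact h

lemma τ_Dhat (m : ℕ) (x : C.X m) : C.Dhat m (C.τ m x) = C.τ m (C.Dhat m x) := by
  have h : ∀ (j : ℕ) (y : C.X m), ((C.τ m : Module.End k (C.X m)) ^ j) (C.τ m y) =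
      C.τ m (((C.τ m : Module.End k (C.X m)) ^ j) y) := fun j y => by
    rw [← Module.End.mul_apply, ← pow_succ, pow_succ', Module.End.mul_apply]
  simp only [Dhat, LinearMap.comp_apply, LinearMap.sum_apply, LinearMap.smul_apply, map_sum,
    map_nsmul, ← rat_map, h]

lemma b'_Nhat (m : ℕ) (x : C.X (m + 1)) :
    C.b' m (C.Nhat (m + 1) x) = C.N m (C.b m (C.rat ((m + 2 : ℚ)⁻¹) (m + 1) x)) := by
  rw [Nhat, LinearMap.comp_apply, ← N_b]
  push_cast
  rw [show (m : ℚ) + 1 + 1 = m + 2 by ring]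

lemma T_Dhat (m : ℕ) (x : C.X m) : C.T m (C.Dhat m x) = C.Dhat m (C.T m x) := by
  simp only [Dhat, LinearMap.comp_apply, LinearMap.sum_apply, LinearMap.smul_apply, map_sum,
    map_nsmul, ← rat_map, T_τpow]

lemma T_bDb (m : ℕ) (x : C.X (m + 2)) : C.T m (C.bDb m x) = C.bDb m (C.T (m + 2) x) := by
  simp only [bDb, bhat', LinearMap.comp_apply, rat_map, T_b', T_Dhat, T_b]

lemma T_bDbTot : ∀ (m : ℕ) (x : C.X m), C.T (m - 2) (C.bDbTot m x) = C.bDbTot m (C.T m x)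
  | 0, x => by simp [bDbTot]
  | 1, x => by simp [bDbTot]
  | m + 2, x => C.T_bDb m x

lemma T_bDbPow (m : ℕ) : ∀ (j : ℕ) (x : C.X m),
    C.T (m - 2 * j) (C.bDbPow m j x) = C.bDbPow m j (C.T m x)
  | 0, x => rfl
  | j + 1, x => by
    have h := T_bDbPow m j x
    have h2 := C.T_bDbTot (m - 2 * j) (C.bDbPow m j x)
    rw [h] at h2
    exact h2

lemma Nhat_τ (m : ℕ) (x : C.X m) :
    C.Nhat m (C.τ m x) = C.Nhat m x - (C.rat ((m + 1 : ℚ)⁻¹) m x -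
      C.T m (C.rat ((m + 1 : ℚ)⁻¹) m x)) := by
  rw [← N_τ, map_sub, rat_map, Nhat, LinearMap.comp_apply, LinearMap.comp_apply]
  simp only [rat_map]
  abel

/-- The operator `S₀` induces a cochain map on cyclic cochains. -/
lemma cyclic_S₀_b {m : ℕ} {φ : C.X m →ₗ[k] k} (hφ : ∀ x, φ (C.τ m x) = φ x)
    (x : C.X (m + 3)) : φ (C.S₀ m (C.b (m + 2) x)) = φ (C.b m (C.S₀ (m + 1) x)) := by
  have key : ∀ {n : ℕ} (y : C.X (n + 1)),
      C.b n (C.Nhat (n + 1) y) =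
        C.b n y - (C.b' n (C.Dhat (n + 1) y) - C.τ n (C.b' n (C.Dhat (n + 1) y))) := by
    intro n y
    rw [← b_τ, ← map_sub]
    exact congrArg _ (eq_sub_of_add_eq (C.Nhat_add (n + 1) y))
  have key2 : ∀ {n : ℕ} (z : C.X n), C.Dhat n (z - C.τ n z) = z - C.Nhat n z := by
    intro n z
    rw [map_sub, τ_Dhat]
    exact eq_sub_of_add_eq' (C.Nhat_add n z)
  have hN : φ.comp (C.rat ((m + 1 : ℚ)⁻¹) m) ∘ₗ C.N m = φ := by
    ext y
    rw [LinearMap.comp_apply, LinearMap.comp_apply, ← rat_map, cyclic_N C hφ, ← map_nsmul,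
      rat_inv_cancel]
  have hN' : ∀ y, φ (C.rat ((m + 1 : ℚ)⁻¹) m (C.N m y)) = φ y := LinearMap.congr_fun hN
  have hb : ∀ y, (φ ∘ₗ C.b m) (C.τ (m + 1) y) = (φ ∘ₗ C.b m) y := C.cyclic_b hφ
  have hbb : ∀ y : C.X (m + 2), φ (C.b m (C.N (m + 1) (C.b (m + 1) y))) = 0 := fun y => by
    have h := C.cyclic_N hb (C.b (m + 1) y)
    rw [LinearMap.comp_apply, LinearMap.comp_apply, b_b, map_zero, smul_zero] at h
    exact h
  obtain ⟨z, hz⟩ : ∃ z, z = C.b' (m + 1) (C.Dhat (m + 2) (C.b (m + 2) x)) := ⟨_, rfl⟩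
  obtain ⟨v, hv⟩ : ∃ v, v = C.b' (m + 2) (C.Dhat (m + 3) x) := ⟨_, rfl⟩
  have hb'z : C.b' m z = 0 := by rw [hz, b'_b']
  have hb'v : C.b' (m + 1) v = 0 := by rw [hv, b'_b']
  have L : C.S₀ m (C.b (m + 2) x) =
      -C.rat ((m + 1 : ℚ)⁻¹) m (C.N m (C.b m (C.rat ((m + 2 : ℚ)⁻¹) (m + 1) z))) := by
    have h1 : C.b (m + 1) (C.Nhat (m + 2) (C.b (m + 2) x)) = -(z - C.τ (m + 1) z) := by
      rw [key, b_b, hz, zero_sub]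
    rw [S₀, LinearMap.neg_apply, LinearMap.comp_apply, bDb, LinearMap.comp_apply,
      LinearMap.comp_apply, h1, map_neg, key2, bhat', LinearMap.comp_apply, map_neg, map_sub,
      hb'z, b'_Nhat, zero_sub, neg_neg]
  have R : C.S₀ (m + 1) x = -C.rat ((m + 2 : ℚ)⁻¹) (m + 1)
      (z + C.N (m + 1) (C.b (m + 1) (C.rat ((m + 3 : ℚ)⁻¹) (m + 2) v))) := by
    have h1 : C.b (m + 2) (C.Nhat (m + 3) x) = C.b (m + 2) x - (v - C.τ (m + 2) v) := by
      rw [key, hv]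
    have h3 := C.b'_Nhat (m + 1) v
    rw [show (((m + 1 : ℕ) : ℚ) + 2) = m + 3 by push_cast; ring] at h3
    rw [S₀, LinearMap.neg_apply, LinearMap.comp_apply, bDb, LinearMap.comp_apply,
      LinearMap.comp_apply, h1, map_sub, key2, bhat', LinearMap.comp_apply, map_sub, map_sub,
      map_sub (C.b' (m + 1)), hb'v, ← hz, h3, zero_sub, map_neg, sub_neg_eq_add, ← map_add,
      show (((m + 1 : ℕ) : ℚ) + 1) = m + 2 by push_cast; ring]
  rw [L, R, map_neg, hN', map_neg, map_neg, map_add, map_add, map_add, rat_map, ← rat_map,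
    ← rat_map, ← rat_map, hbb, add_zero]

end Rat

end ParaPrecyclicModule

/-! ### `ℤ/2`-graded complexes -/

/-- A `ℤ/2`-graded cochain complex `M = M⁰ ⊕ M¹` of `R`-modules with odd differential `d`. -/
structure Z2Complex (R : Type u) [Ring R] where
  M : Type v
  [addCommGroup : AddCommGroup M]
  [module : Module R M]
  gr : ZMod 2 → Submodule R M
  isCompl : IsCompl (gr 0) (gr 1)
  d : M →ₗ[R] M
  d_mem : ∀ i, ∀ x ∈ gr i, d x ∈ gr (i + 1)
  d_d : ∀ x, d (d x) = 0

attribute [instance] Z2Complex.addCommGroup Z2Complex.module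

namespace Z2Complex

variable {R : Type u} [Ring R] (K L : Z2Complex.{u, v} R)

/-- Cocycles of degree `i`. -/
def cocycles (i : ZMod 2) : Submodule R K.M := K.gr i ⊓ LinearMap.ker K.d

/-- Coboundaries of degree `i` (in `ℤ/2`, `i - 1 = i + 1`). -/
def coboundaries (i : ZMod 2) : Submodule R K.M := (K.gr (i + 1)).map K.d

/-- The cohomology `Hⁱ(K)`. -/
abbrev H (i : ZMod 2) : Type v := K.cocycles i ⧸ (K.coboundaries i).submoduleOf (K.cocycles i)

/-- The class of a cocycle. -/
def cls {i : ZMod 2} (x : K.M) (hx : x ∈ K.gr i) (hd : K.d x = 0) : K.H i :=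
  Submodule.Quotient.mk ⟨x, hx, LinearMap.mem_ker.mpr hd⟩

/-- Cochain maps of `ℤ/2`-graded complexes. -/
structure Hom where
  f : K.M →ₗ[R] L.M
  map_gr : ∀ i, ∀ x ∈ K.gr i, f x ∈ L.gr i
  comm : ∀ x, f (K.d x) = L.d (f x)

variable {K L}

lemma Hom.map_cocycles (F : Hom K L) (i : ZMod 2) : ∀ x ∈ K.cocycles i, F.f x ∈ L.cocycles i :=
  fun x hx => ⟨F.map_gr i x hx.1, by
    change L.d (F.f x) = 0
    rw [← F.comm, LinearMap.mem_ker.mp hx.2, map_zero]⟩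

/-- The map induced in cohomology. -/
def Hom.mapH (F : Hom K L) (i : ZMod 2) : K.H i →ₗ[R] L.H i :=
  Submodule.mapQ _ _ (F.f.restrict (F.map_cocycles i)) (by
    rintro ⟨x, hx⟩ ⟨y, hy, hxy⟩
    refine ⟨F.f y, F.map_gr _ y hy, ?_⟩
    rw [← F.comm, hxy]
    rfl)

/-- A cochain map is a quasi-isomorphism when it is bijective in cohomology. -/
def Hom.IsQuasiIso (F : Hom K L) : Prop := ∀ i, Function.Bijective (F.mapH i)

end Z2Complex

/-! ### Periodic direct limits -/

section PeriodicLimit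

variable {R : Type u} [Ring R] (A : ℕ → Type v) [∀ n, AddCommGroup (A n)] [∀ n, Module R (A n)]

/-- The elements of `⨁ₙ Aⁿ` supported in degrees `n ≡ i mod 2`, i.e., `⨁_q A^{2q+i}`. -/
def parity (R : Type u) [Ring R] (A : ℕ → Type v) [∀ n, AddCommGroup (A n)]
    [∀ n, Module R (A n)] (i : ZMod 2) : Submodule R (⨁ n, A n) where
  carrier := {x | ∀ n : ℕ, (n : ZMod 2) ≠ i → x n = 0}
  zero_mem' := fun n _ => rfl
  add_mem' := fun {x y} hx hy n hn => by
    rw [DirectSum.add_apply, hx n hn, hy n hn, add_zero]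
  smul_mem' := fun c x hx n hn => by
    rw [DirectSum.smul_apply, hx n hn, smul_zero]

lemma lof_mem_parity {n : ℕ} {i : ZMod 2} (hn : (n : ZMod 2) = i) (a : A n) :
    DirectSum.lof R ℕ A n a ∈ parity R A i := fun m hm => by
  rw [DirectSum.lof_eq_of, DirectSum.of_eq_of_ne]
  rintro rfl
  exact hm hn

lemma parity_isCompl : IsCompl (parity R A 0) (parity R A 1) := by
  have h2 : ∀ z : ZMod 2, z = 0 ∨ z = 1 := by decide
  have h01 : (0 : ZMod 2) ≠ 1 := by decide
  constructor
  · rw [Submodule.disjoint_def]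
    intro x h0 h1
    ext n : 1
    rcases h2 (n : ZMod 2) with h | h
    · exact h1 n (by rw [h]; exact h01)
    · exact h0 n (by rw [h]; exact h01.symm)
  · rw [codisjoint_iff, eq_top_iff]
    rintro x -
    induction x using DirectSum.induction_on with
    | zero => exact zero_mem _
    | of n a =>
      rcases h2 (n : ZMod 2) with h | h
      · exact Submodule.mem_sup_left (lof_mem_parity A h a)
      · exact Submodule.mem_sup_right (lof_mem_parity A h a)
    | add x y hx hy => exact add_mem hx hy

/-- A linear map out of `⨁ₙ Aⁿ` sends `⨁_{n ≡ i} Aⁿ` to a submodule as soon as it does so on each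
`Aⁿ`. -/
lemma parity_induction {P : Type*} [AddCommGroup P] [Module R P] {i : ZMod 2} (Q : Submodule R P)
    (f : (⨁ n, A n) →ₗ[R] P)
    (h : ∀ n : ℕ, (n : ZMod 2) = i → ∀ a, f (DirectSum.lof R ℕ A n a) ∈ Q) :
    ∀ x ∈ parity R A i, f x ∈ Q := by
  classical
  intro x hx
  rw [← DirectSum.sum_support_of x, map_sum]
  refine Submodule.sum_mem _ fun n hn => ?_
  rw [DFinsupp.mem_support_toFun] at hn
  exact h n (by by_contra hne; exact hn (hx n hne)) _

variable {A} (S : ∀ n, A n →ₗ[R] A (n + 2))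

/-- The operator `S` on `⨁ₙ Aⁿ`. -/
def shift : (⨁ n, A n) →ₗ[R] ⨁ n, A n :=
  DirectSum.toModule R ℕ _ fun n => DirectSum.lof R ℕ A (n + 2) ∘ₗ S n

lemma shift_lof (n : ℕ) (a : A n) :
    shift S (DirectSum.lof R ℕ A n a) = DirectSum.lof R ℕ A (n + 2) (S n a) := by
  simp [shift]

lemma shift_mem (i : ZMod 2) : ∀ x ∈ parity R A i, shift S x ∈ parity R A i :=
  parity_induction A _ _ fun n hn a => by
    rw [shift_lof]
    refine lof_mem_parity A ?_ _
    rw [← hn, Nat.cast_add]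
    exact add_eq_left.mpr (by decide)

/-- The quotient `(⨁ₙ Aⁿ) / ran (1 - S)`; its degree `i` component (`i ∈ ℤ/2`) is the direct limit
of the modules `A^{2q+i}`, `q ≥ 0`, under `S`. -/
abbrev SLim : Type v := (⨁ n, A n) ⧸ LinearMap.range (LinearMap.id - shift S)

/-- The canonical projection `⨁ₙ Aⁿ → SLim S`. -/
abbrev SLim.mk : (⨁ n, A n) →ₗ[R] SLim S := Submodule.mkQ _

/-- The component `(⨁_q A^{2q+i}) / ran (1 - S)`, i.e., the direct limit of the `A^{2q+i}`. -/
def SLim.gr (i : ZMod 2) : Submodule R (SLim S) := (parity R A i).map (SLim.mk S)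

lemma SLim.isCompl : IsCompl (SLim.gr S 0) (SLim.gr S 1) := by
  obtain ⟨hd, hc⟩ := parity_isCompl (R := R) A
  constructor
  · rw [Submodule.disjoint_def]
    rintro _ ⟨a, ha, rfl⟩ ⟨b, hb, hab⟩
    obtain ⟨c, hc'⟩ := (Submodule.Quotient.eq _).mp hab
    obtain ⟨c0, h0, c1, h1, rfl⟩ := Submodule.mem_sup.mp
      (show c ∈ parity R A 0 ⊔ parity R A 1 by rw [codisjoint_iff.mp hc]; trivial)
    simp only [LinearMap.sub_apply, LinearMap.id_apply, map_add] at hc'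
    have e : a + (c0 - shift S c0) = b - (c1 - shift S c1) := by
      rw [eq_sub_iff_add_eq, add_assoc, ← eq_sub_iff_add_eq', ← hc']
    have z := Submodule.disjoint_def.mp hd (a + (c0 - shift S c0))
      (add_mem ha (sub_mem h0 (shift_mem S 0 _ h0)))
      (by rw [e]; exact sub_mem hb (sub_mem h1 (shift_mem S 1 _ h1)))
    refine (Submodule.Quotient.mk_eq_zero _).mpr ⟨-c0, ?_⟩
    rw [map_neg, LinearMap.sub_apply, LinearMap.id_apply]
    exact (eq_neg_of_add_eq_zero_left z).symm
  · rw [codisjoint_iff, SLim.gr, SLim.gr, ← Submodule.map_sup, codisjoint_iff.mp hc,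
      Submodule.map_top, Submodule.range_mkQ]

/-- The class of `a ∈ Aⁿ` in the direct limit, for `n ≡ i mod 2`. -/
def SLim.of {n : ℕ} {i : ZMod 2} (hn : (n : ZMod 2) = i) (a : A n) : SLim.gr S i :=
  ⟨SLim.mk S (DirectSum.lof R ℕ A n a), _, lof_mem_parity A hn a, rfl⟩

end PeriodicLimit

/-! ### `H`-unital para-precyclic modules -/

/-- An `H`-unital para-precyclic module `(C, d, s, t)`: a para-precyclic module with a
`T`-compatible contracting homotopy `s` of its bar complex. -/
structure HUnitalParaPrecyclicModule (k : Type u) [Ring k] extends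
    ParaPrecyclicModule.{u, v} k where
  s : ∀ m, X m →ₗ[k] X (m + 1)
  b'_s_zero : toParaPrecyclicModule.b' 0 ∘ₗ s 0 = LinearMap.id
  b'_s : ∀ m, toParaPrecyclicModule.b' (m + 1) ∘ₗ s (m + 1) + s m ∘ₗ toParaPrecyclicModule.b' m =
    LinearMap.id
  T_s : ∀ m, toParaPrecyclicModule.T (m + 1) ∘ₗ s m = s m ∘ₗ toParaPrecyclicModule.T m

namespace HUnitalParaPrecyclicModule

variable {k : Type u} [Ring k] (C : HUnitalParaPrecyclicModule.{u, v} k)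

/-- The special contracting homotopy `s' = s b' s`. -/
def s' (m : ℕ) : C.X m →ₗ[k] C.X (m + 1) := C.s m ∘ₗ C.b' m ∘ₗ C.s m

/-- `B = (1 - τ) s' N : C_m → C_{m+1}`. -/
def B (m : ℕ) : C.X m →ₗ[k] C.X (m + 1) :=
  (LinearMap.id - C.τ (m + 1)) ∘ₗ C.s' m ∘ₗ C.N m

/-- `1 - (1 - τ) s' D̂ b` on `C_m` (with `b = 0` on `C_0`). -/
def ρ [Algebra ℚ k] : ∀ m : ℕ, C.X m →ₗ[k] C.X m
  | 0 => LinearMap.id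
  | m + 1 => LinearMap.id -
      (LinearMap.id - C.τ (m + 1)) ∘ₗ C.s' m ∘ₗ C.Dhat m ∘ₗ C.b m

lemma T_s' (m : ℕ) (x : C.X m) : C.T (m + 1) (C.s' m x) = C.s' m (C.T m x) := by
  have h : ∀ y, C.T (m + 1) (C.s m y) = C.s m (C.T m y) := LinearMap.congr_fun (C.T_s m)
  simp only [s', LinearMap.comp_apply, h, C.T_b']

lemma T_B (m : ℕ) (x : C.X m) : C.T (m + 1) (C.B m x) = C.B m (C.T m x) := by
  simp only [B, LinearMap.comp_apply, LinearMap.sub_apply, LinearMap.id_apply, map_sub, C.T_τ,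
    T_s', C.T_N]

lemma T_ρ [Algebra ℚ k] : ∀ (m : ℕ) (x : C.X m), C.T m (C.ρ m x) = C.ρ m (C.T m x)
  | 0, _ => rfl
  | m + 1, x => by
    simp only [ρ, LinearMap.comp_apply, LinearMap.sub_apply, LinearMap.id_apply, map_sub, C.T_τ,
      T_s', C.T_Dhat, C.T_b]

lemma b'_s'_zero (x : C.X 0) : C.b' 0 (C.s' 0 x) = x := by
  have h : ∀ y, C.b' 0 (C.s 0 y) = y := LinearMap.congr_fun C.b'_s_zero
  simp only [s', LinearMap.comp_apply, h]

/-- `b' s' + s' b' = 1` -/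
lemma b'_s'_add (m : ℕ) (x : C.X (m + 1)) :
    C.b' (m + 1) (C.s' (m + 1) x) + C.s' m (C.b' m x) = x := by
  have h : ∀ y, C.b' (m + 1) (C.s (m + 1) y) = y - C.s m (C.b' m y) := fun y =>
    eq_sub_of_add_eq (LinearMap.congr_fun (C.b'_s m) y)
  have h2 : C.b' m (C.s m (C.b' m x)) = C.b' m x := by
    have h3 := congrArg (C.b' m) (h x)
    rw [C.b'_b', map_sub] at h3
    exact (sub_eq_zero.mp h3.symm).symm
  simp only [s', LinearMap.comp_apply, h, h2, map_sub]
  abel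

/-! ### Cochains -/

/-- The semiring structure of `kᵐᵒᵖ`, as the one underlying its ring structure. -/
instance opSemiring {k : Type u} [Ring k] : Semiring kᵐᵒᵖ :=
  (MulOpposite.instRing : Ring kᵐᵒᵖ).toSemiring

/-- The right `k`-module `Hom_k(M, k)`, where `(φ a)(x) = φ(x) a`. -/
def Dual (k : Type u) [Ring k] (M : Type v) [AddCommGroup M] [Module k M] : Type (max u v) :=
  M →ₗ[k] k

instance instAddCommGroupDual (k : Type u) [Ring k] (M : Type v) [AddCommGroup M] [Module k M] :
    AddCommGroup (Dual k M) :=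
  inferInstanceAs (AddCommGroup (M →ₗ[k] k))

instance instModuleDual (k : Type u) [Ring k] (M : Type v) [AddCommGroup M] [Module k M] :
    Module kᵐᵒᵖ (Dual k M) :=
  inferInstanceAs (Module kᵐᵒᵖ (M →ₗ[k] k))

instance instFunLikeDual (k : Type u) [Ring k] (M : Type v) [AddCommGroup M] [Module k M] :
    FunLike (Dual k M) M k :=
  inferInstanceAs (FunLike (M →ₗ[k] k) M k)

instance instLinearMapClassDual (k : Type u) [Ring k] (M : Type v) [AddCommGroup M] [Module k M] :
    LinearMapClass (Dual k M) k M k :=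
  inferInstanceAs (LinearMapClass (M →ₗ[k] k) k M k)

/-- Transposition `φ ↦ φ ∘ f`, as a map of right `k`-modules. -/
def dual {M N : Type v} [AddCommGroup M] [Module k M] [AddCommGroup N] [Module k N]
    (f : M →ₗ[k] N) : Dual k N →ₗ[kᵐᵒᵖ] Dual k M where
  toFun φ := LinearMap.comp φ f
  map_add' _ _ := rfl
  map_smul' _ _ := rfl

/-- The right `k`-module `C_T^m = {φ ∈ Hom_k(C_m, k) : φ ∘ T = φ}`. -/
def CT (m : ℕ) : Submodule kᵐᵒᵖ (Dual k (C.X m)) := LinearMap.ker (dual (C.T m) - LinearMap.id)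

/-- The right `k`-module `C_λ^m = {φ ∈ Hom_k(C_m, k) : φ ∘ τ = φ}` of cyclic cochains. -/
def Cl (m : ℕ) : Submodule kᵐᵒᵖ (Dual k (C.X m)) := LinearMap.ker (dual (C.τ m) - LinearMap.id)

lemma mem_CT {m : ℕ} {φ : Dual k (C.X m)} : φ ∈ C.CT m ↔ ∀ x, φ (C.T m x) = φ x := by
  rw [CT, LinearMap.mem_ker, LinearMap.sub_apply, sub_eq_zero]
  exact ⟨fun h x => DFunLike.congr_fun h x, fun h => DFunLike.ext _ _ h⟩

lemma mem_Cl {m : ℕ} {φ : Dual k (C.X m)} : φ ∈ C.Cl m ↔ ∀ x, φ (C.τ m x) = φ x := by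
  rw [Cl, LinearMap.mem_ker, LinearMap.sub_apply, sub_eq_zero]
  exact ⟨fun h x => DFunLike.congr_fun h x, fun h => DFunLike.ext _ _ h⟩

lemma Cl_le_CT (m : ℕ) : C.Cl m ≤ C.CT m := fun _ h =>
  C.mem_CT.mpr (C.cyclic_T (C.mem_Cl.mp h))

/-- `b : C_T^m → C_T^{m+1}` -/
def bT (m : ℕ) : C.CT m →ₗ[kᵐᵒᵖ] C.CT (m + 1) :=
  (dual (C.b m)).restrict fun φ hφ => C.mem_CT.mpr fun x => by
    change φ (C.b m (C.T (m + 1) x)) = φ (C.b m x)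
    rw [← C.T_b, C.mem_CT.mp hφ]

/-- `B : C_T^{m+1} → C_T^m` -/
def BT (m : ℕ) : C.CT (m + 1) →ₗ[kᵐᵒᵖ] C.CT m :=
  (dual (C.B m)).restrict fun φ hφ => C.mem_CT.mpr fun x => by
    change φ (C.B m (C.T m x)) = φ (C.B m x)
    rw [← C.T_B, C.mem_CT.mp hφ]

/-- `b : C_λ^m → C_λ^{m+1}` -/
def bl (m : ℕ) : C.Cl m →ₗ[kᵐᵒᵖ] C.Cl (m + 1) :=
  (dual (C.b m)).restrict fun _ hφ => C.mem_Cl.mpr (C.cyclic_b (C.mem_Cl.mp hφ))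

lemma bT_bT (m : ℕ) (φ : C.CT m) : C.bT (m + 1) (C.bT m φ) = 0 :=
  Subtype.ext <| DFunLike.ext _ _ fun x => by
    change φ.1 (C.b m (C.b (m + 1) x)) = 0
    rw [C.b_b, map_zero]

lemma bl_bl (m : ℕ) (φ : C.Cl m) : C.bl (m + 1) (C.bl m φ) = 0 :=
  Subtype.ext <| DFunLike.ext _ _ fun x => by
    change φ.1 (C.b m (C.b (m + 1) x)) = 0
    rw [C.b_b, map_zero]

lemma BT_BT (m : ℕ) (φ : C.CT (m + 2)) : C.BT m (C.BT (m + 1) φ) = 0 :=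
  Subtype.ext <| DFunLike.ext _ _ fun x => by
    have h := C.mem_CT.mp φ.2
    change φ.1 (C.B (m + 1) (C.B m x)) = 0
    simp only [B, LinearMap.comp_apply, LinearMap.sub_apply, LinearMap.id_apply]
    rw [C.N_τ, map_sub (C.s' (m + 1)), ← C.T_s', map_sub (C.τ (m + 1 + 1)), ← C.T_τ, map_sub,
      map_sub, map_sub, h, h, sub_self, sub_self, sub_self]

lemma bT_BT_zero (φ : C.CT 0) : C.BT 0 (C.bT 0 φ) = 0 :=
  Subtype.ext <| DFunLike.ext _ _ fun x => by
    have h := C.mem_CT.mp φ.2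
    change φ.1 (C.b 0 (C.B 0 x)) = 0
    simp only [B, LinearMap.comp_apply, LinearMap.sub_apply, LinearMap.id_apply]
    rw [C.b_τ, b'_s'_zero, C.N_sub_τ_N, map_sub, h, sub_self]

lemma bT_BT (m : ℕ) (φ : C.CT (m + 1)) :
    C.BT (m + 1) (C.bT (m + 1) φ) + C.bT m (C.BT m φ) = 0 :=
  Subtype.ext <| DFunLike.ext _ _ fun x => by
    have h := C.mem_CT.mp φ.2
    change φ.1 (C.b (m + 1) (C.B (m + 1) x)) + φ.1 (C.B m (C.b m x)) = 0
    simp only [B, LinearMap.comp_apply, LinearMap.sub_apply, LinearMap.id_apply]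
    have e := C.b'_s'_add m (C.N (m + 1) x)
    rw [C.b_τ, ← map_add, C.N_b, sub_add_sub_comm, e, ← map_add, e, C.N_sub_τ_N, map_sub, h,
      sub_self]

lemma BT_cyclic (m : ℕ) (φ : C.CT (m + 1)) (h : φ.1 ∈ C.Cl (m + 1)) : C.BT m φ = 0 :=
  Subtype.ext <| DFunLike.ext _ _ fun x => by
    change φ.1 (C.B m x) = 0
    simp only [B, LinearMap.comp_apply, LinearMap.sub_apply, LinearMap.id_apply]
    rw [map_sub, C.mem_Cl.mp h, sub_self]

/-! ### The cochain complexes `C_{T,♮}` and `C_{T,♯}` -/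

/-- Finitely supported families `(φₙ)`, `φₙ ∈ C_T^n`. -/
abbrev CTTot : Type (max u v) := ⨁ n, C.CT n

/-- The inclusion of `C_T^n` in degree `n`. -/
abbrev inT (n : ℕ) : C.CT n →ₗ[kᵐᵒᵖ] C.CTTot := DirectSum.lof kᵐᵒᵖ ℕ (fun n => C.CT n) n

/-- `b + B` on `C_T^n`. -/
def DComp : ∀ n : ℕ, C.CT n →ₗ[kᵐᵒᵖ] C.CTTot
  | 0 => C.inT 1 ∘ₗ C.bT 0
  | n + 1 => C.inT (n + 2) ∘ₗ C.bT (n + 1) + C.inT n ∘ₗ C.BT n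

/-- The differential `b + B`. -/
def D : C.CTTot →ₗ[kᵐᵒᵖ] C.CTTot := DirectSum.toModule kᵐᵒᵖ ℕ _ C.DComp

lemma D_inT_zero (φ : C.CT 0) : C.D (C.inT 0 φ) = C.inT 1 (C.bT 0 φ) :=
  DirectSum.toModule_lof _ _ _

lemma D_inT_succ (n : ℕ) (φ : C.CT (n + 1)) :
    C.D (C.inT (n + 1) φ) = C.inT (n + 2) (C.bT (n + 1) φ) + C.inT n (C.BT n φ) :=
  DirectSum.toModule_lof _ _ _

lemma D_D (φ : C.CTTot) : C.D (C.D φ) = 0 := by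
  have : C.D ∘ₗ C.D = 0 := by
    refine DirectSum.linearMap_ext _ fun n => LinearMap.ext fun φ => ?_
    change C.D (C.D (C.inT n φ)) = 0
    rcases n with _ | _ | n
    · rw [D_inT_zero, D_inT_succ, bT_bT, bT_BT_zero, map_zero, map_zero, add_zero]
    · rw [D_inT_succ, map_add, D_inT_succ, D_inT_zero, bT_bT, map_zero, zero_add, ← map_add,
        bT_BT, map_zero]
    · rw [D_inT_succ, map_add, D_inT_succ, D_inT_succ, bT_bT, BT_BT, map_zero, map_zero, zero_add,
        add_zero, ← map_add, bT_BT, map_zero]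
  exact LinearMap.congr_fun this φ

lemma D_parity (i : ZMod 2) : ∀ x ∈ parity kᵐᵒᵖ (fun n => C.CT n) i,
    C.D x ∈ parity kᵐᵒᵖ (fun n => C.CT n) (i + 1) :=
  parity_induction _ _ _ fun n hn φ => by
    rcases n with _ | n
    · refine (C.D_inT_zero φ) ▸ lof_mem_parity (fun n => C.CT n) ?_ _
      rw [← hn]; rfl
    · refine (C.D_inT_succ n φ) ▸ add_mem (lof_mem_parity (fun n => C.CT n) ?_ _)
        (lof_mem_parity (fun n => C.CT n) ?_ _)
      · rw [← hn]; push_cast; ring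
      · rw [← hn]; push_cast
        rw [add_assoc]; exact (add_eq_left.mpr (by decide)).symm

/-- The periodic cochain complex `C_{T,♯}`, with `C_{T,♯}^i = ⨁_q C_T^{2q+i}` and differential
`b + B`. -/
def CTSharp : Z2Complex.{u, max u v} kᵐᵒᵖ where
  M := C.CTTot
  gr := parity kᵐᵒᵖ fun n => C.CT n
  isCompl := parity_isCompl _
  d := C.D
  d_mem := C.D_parity
  d_d := C.D_D

/-- The periodic cyclic cohomology `HP^i(C_T)`. -/
abbrev HP (i : ZMod 2) : Type (max u v) := C.CTSharp.H i

/-- `C_{T,♮}^m = C_T^m ⊕ C_T^{m-2} ⊕ ⋯`, the families supported in degrees `m, m-2, …`. -/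
def CTNat (m : ℕ) : Submodule kᵐᵒᵖ C.CTTot where
  carrier := {φ | ∀ n : ℕ, (¬ ∃ j, n + 2 * j = m) → φ n = 0}
  zero_mem' := fun n _ => rfl
  add_mem' := fun {x y} hx hy n hn => by
    rw [DirectSum.add_apply, hx n hn, hy n hn, add_zero]
  smul_mem' := fun c x hx n hn => by
    rw [DirectSum.smul_apply, hx n hn, smul_zero]

lemma inT_mem_CTNat {n m : ℕ} (h : ∃ j, n + 2 * j = m) (φ : C.CT n) : C.inT n φ ∈ C.CTNat m :=
  fun l hl => by
    rw [DirectSum.lof_eq_of, DirectSum.of_eq_of_ne]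
    rintro rfl
    exact hl h

lemma D_mem_CTNat (m : ℕ) : ∀ φ ∈ C.CTNat m, C.D φ ∈ C.CTNat (m + 1) := by
  classical
  intro φ hφ
  rw [← DirectSum.sum_support_of φ, map_sum]
  refine Submodule.sum_mem _ fun n hn => ?_
  rw [DFinsupp.mem_support_toFun] at hn
  obtain ⟨j, hj⟩ : ∃ j, n + 2 * j = m := by by_contra hne; exact hn (hφ n hne)
  rcases n with _ | n
  · exact (C.D_inT_zero (φ 0)) ▸ C.inT_mem_CTNat ⟨j, by omega⟩ _
  · exact (C.D_inT_succ n (φ (n + 1))) ▸ add_mem (C.inT_mem_CTNat ⟨j, by omega⟩ _)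
      (C.inT_mem_CTNat ⟨j + 1, by omega⟩ _)

/-- The differential `b + B : C_{T,♮}^m → C_{T,♮}^{m+1}`. -/
def DNat (m : ℕ) : C.CTNat m →ₗ[kᵐᵒᵖ] C.CTNat (m + 1) := C.D.restrict (C.D_mem_CTNat m)

/-- The coboundaries in `C_{T,♮}^m`. -/
def coboundariesNat : ∀ m : ℕ, Submodule kᵐᵒᵖ (C.CTNat m)
  | 0 => ⊥
  | m + 1 => LinearMap.range (C.DNat m)

/-! ### The cyclic cochain complex `C_λ` and its inclusions -/

/-- The inclusion `C_λ^m → C_T^m`. -/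
abbrev incl (m : ℕ) : C.Cl m →ₗ[kᵐᵒᵖ] C.CT m := Submodule.inclusion (C.Cl_le_CT m)

/-- The inclusion `ι_♮ : C_λ^m → C_{T,♮}^m`, `φ ↦ (φ, 0, …)`. -/
def ιNat (m : ℕ) : C.Cl m →ₗ[kᵐᵒᵖ] C.CTNat m :=
  LinearMap.codRestrict _ (C.inT m ∘ₗ C.incl m) fun _ => C.inT_mem_CTNat ⟨0, rfl⟩ _

/-- Cyclic cocycles. -/
def Zl (m : ℕ) : Submodule kᵐᵒᵖ (C.Cl m) := LinearMap.ker (C.bl m)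

/-- Cyclic coboundaries. -/
def Bl : ∀ m : ℕ, Submodule kᵐᵒᵖ (C.Cl m)
  | 0 => ⊥
  | m + 1 => LinearMap.range (C.bl m)

/-- The cyclic cohomology `H_λ^m(C)`. -/
def Hl (m : ℕ) : Type (max u v) := C.Zl m ⧸ (C.Bl m).submoduleOf (C.Zl m)

instance instAddCommGroupHl (m : ℕ) : AddCommGroup (C.Hl m) :=
  inferInstanceAs (AddCommGroup (C.Zl m ⧸ (C.Bl m).submoduleOf (C.Zl m)))

instance instModuleHl (m : ℕ) : Module kᵐᵒᵖ (C.Hl m) :=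
  inferInstanceAs (Module kᵐᵒᵖ (C.Zl m ⧸ (C.Bl m).submoduleOf (C.Zl m)))

/-- The class of a cyclic cocycle in `H_λ^m(C)`. -/
def clsl (m : ℕ) : C.Zl m →ₗ[kᵐᵒᵖ] C.Hl m := Submodule.mkQ ((C.Bl m).submoduleOf (C.Zl m))

lemma D_incl (m : ℕ) (φ : C.Cl m) :
    C.D (C.inT m (C.incl m φ)) = C.inT (m + 1) (C.incl (m + 1) (C.bl m φ)) := by
  rcases m with _ | m
  · exact C.D_inT_zero _
  · refine (C.D_inT_succ m _).trans ?_
    rw [C.BT_cyclic m _ φ.2, map_zero, add_zero]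
    rfl

/-- The class in `HP^i(C_T)` of a cyclic cocycle of degree `m ≡ i mod 2`. -/
def clsHP {m : ℕ} {i : ZMod 2} (hm : (m : ZMod 2) = i) (φ : C.Zl m) : C.HP i :=
  C.CTSharp.cls (C.inT m (C.incl m φ.1)) (lof_mem_parity (fun n => C.CT n) hm _) (by
    refine (C.D_incl m φ.1).trans ?_
    rw [LinearMap.mem_ker.mp φ.2, map_zero, map_zero]
    rfl)

/-- The inclusion of `C_λ^n` in degree `n`. -/
abbrev inl (n : ℕ) : C.Cl n →ₗ[kᵐᵒᵖ] ⨁ n, C.Cl n := DirectSum.lof kᵐᵒᵖ ℕ (fun n => C.Cl n) n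

/-- `b` on `⨁ₙ C_λ^n`. -/
def blTot : (⨁ n, C.Cl n) →ₗ[kᵐᵒᵖ] ⨁ n, C.Cl n :=
  DirectSum.toModule kᵐᵒᵖ ℕ _ fun n => C.inl (n + 1) ∘ₗ C.bl n

lemma blTot_inl (n : ℕ) (φ : C.Cl n) : C.blTot (C.inl n φ) = C.inl (n + 1) (C.bl n φ) :=
  DirectSum.toModule_lof _ _ _

section Rat

variable [Algebra ℚ k]

/-! ### The periodicity operator -/

/-- The periodicity operator `S : C_λ^m → C_λ^{m+2}`, `φ ↦ φ ∘ S₀`. -/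
def S (m : ℕ) : C.Cl m →ₗ[kᵐᵒᵖ] C.Cl (m + 2) :=
  (dual (C.S₀ m)).restrict fun φ hφ => C.mem_Cl.mpr fun x => by
    have h := C.mem_CT.mp (C.Cl_le_CT m hφ)
    change φ (C.S₀ m (C.τ (m + 2) x)) = φ (C.S₀ m x)
    simp only [ParaPrecyclicModule.S₀, LinearMap.neg_apply, LinearMap.comp_apply, C.Nhat_τ,
      map_sub, map_neg, ← C.T_bDb, h]
    abel

lemma S_bl (m : ℕ) (φ : C.Cl m) : C.S (m + 1) (C.bl m φ) = C.bl (m + 2) (C.S m φ) :=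
  Subtype.ext <| DFunLike.ext _ _ fun x => (C.cyclic_S₀_b (C.mem_Cl.mp φ.2) x).symm

/-- The periodicity operator `S : H_λ^m(C) → H_λ^{m+2}(C)`. -/
def SH (m : ℕ) : C.Hl m →ₗ[kᵐᵒᵖ] C.Hl (m + 2) :=
  Submodule.mapQ ((C.Bl m).submoduleOf (C.Zl m)) ((C.Bl (m + 2)).submoduleOf (C.Zl (m + 2)))
    ((C.S m).restrict (p := C.Zl m) (q := C.Zl (m + 2)) fun φ hφ => by
      rw [Zl, LinearMap.mem_ker, ← S_bl, LinearMap.mem_ker.mp hφ, map_zero]) (by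
    rintro ⟨φ, hφ⟩ h
    rcases m with _ | m
    · have h0 : φ = 0 := h
      subst h0
      exact Submodule.zero_mem _
    · obtain ⟨ψ, rfl⟩ := h
      exact ⟨C.S m ψ, (C.S_bl m ψ).symm⟩)

/-- The class in `lim_S H_λ^{2q+i}(C)` of a cyclic cocycle of degree `m ≡ i mod 2`. -/
def clsLim {m : ℕ} {i : ZMod 2} (hm : (m : ZMod 2) = i) (φ : C.Zl m) : SLim.gr C.SH i :=
  SLim.of C.SH hm (C.clsl m φ)

/-- The direct limit `lim_S H_λ^{2q+i}(C)`. -/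
abbrev limHl (i : ZMod 2) : Submodule kᵐᵒᵖ (SLim C.SH) := SLim.gr C.SH i

lemma blTot_shift (x : ⨁ n, C.Cl n) : C.blTot (shift C.S x) = shift C.S (C.blTot x) := by
  have : C.blTot ∘ₗ shift C.S = shift C.S ∘ₗ C.blTot := by
    refine DirectSum.linearMap_ext _ fun n => LinearMap.ext fun φ => ?_
    change C.blTot (shift C.S (C.inl n φ)) = shift C.S (C.blTot (C.inl n φ))
    rw [shift_lof, blTot_inl, blTot_inl, shift_lof, S_bl]
  exact LinearMap.congr_fun this x

/-- The periodic cochain complex `C_{λ,♯}`, with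
`C_{λ,♯}^i = (⨁_q C_λ^{2q+i}) / ran (1 - S)` and differential `b`. -/
def ClSharp : Z2Complex.{u, max u v} kᵐᵒᵖ where
  M := SLim C.S
  gr := SLim.gr C.S
  isCompl := SLim.isCompl C.S
  d := Submodule.mapQ _ _ C.blTot (by
    rintro _ ⟨x, rfl⟩
    refine ⟨C.blTot x, ?_⟩
    rw [LinearMap.sub_apply, LinearMap.sub_apply, map_sub, blTot_shift]
    rfl)
  d_mem := by
    rintro i _ ⟨x, hx, rfl⟩
    refine ⟨C.blTot x, ?_, rfl⟩
    refine parity_induction _ (parity kᵐᵒᵖ (fun n => C.Cl n) (i + 1)) C.blTot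
      (fun n hn φ => ?_) x hx
    refine (C.blTot_inl n φ) ▸ lof_mem_parity (fun n => C.Cl n) ?_ _
    rw [← hn]; push_cast; rfl
  d_d := by
    have : C.blTot ∘ₗ C.blTot = 0 := by
      refine DirectSum.linearMap_ext _ fun n => LinearMap.ext fun φ => ?_
      change C.blTot (C.blTot (C.inl n φ)) = 0
      rw [blTot_inl, blTot_inl, bl_bl, map_zero]
    intro x
    obtain ⟨x, rfl⟩ := Submodule.mkQ_surjective _ x
    simp only [Submodule.mkQ_apply, Submodule.mapQ_apply]
    rw [show C.blTot (C.blTot x) = 0 from LinearMap.congr_fun this x, Submodule.Quotient.mk_zero]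

/-- The cohomology `H_{λ,♯}^i(C)` of `C_{λ,♯}`. -/
abbrev HlSharp (i : ZMod 2) : Type (max u v) := C.ClSharp.H i

/-- The class in `H_{λ,♯}^i(C)` of a cyclic cocycle of degree `m ≡ i mod 2`. -/
def clsSharp {m : ℕ} {i : ZMod 2} (hm : (m : ZMod 2) = i) (φ : C.Zl m) : C.HlSharp i :=
  C.ClSharp.cls (SLim.mk C.S (C.inl m φ.1)) ⟨_, lof_mem_parity (fun n => C.Cl n) hm _, rfl⟩ (by
    change SLim.mk C.S (C.blTot (C.inl m φ.1)) = 0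
    rw [blTot_inl, LinearMap.mem_ker.mp φ.2, map_zero, map_zero])

/-! ### The maps `ν_♮` and `ν_♯` -/

/-- `φ ↦ φ ∘ {[1 - (1-τ)s'D̂b] (b̂'D̂b)^j N̂}`, `C_T^{m-2j} → C_λ^m`. -/
def νComp (m j : ℕ) : C.CT (m - 2 * j) →ₗ[kᵐᵒᵖ] C.Cl m :=
  (dual (C.ρ (m - 2 * j) ∘ₗ C.bDbPow m j ∘ₗ C.Nhat m)).restrict fun φ hφ =>
    C.mem_Cl.mpr fun x => by
      have h := C.mem_CT.mp hφ
      change φ (C.ρ _ (C.bDbPow m j (C.Nhat m (C.τ m x)))) =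
        φ (C.ρ _ (C.bDbPow m j (C.Nhat m x)))
      rw [C.Nhat_τ]
      simp only [map_sub, ← C.T_bDbPow, ← C.T_ρ, h]
      abel

/-- The cochain map `ν_♮ : C_{T,♮}^m → C_λ^m`,
`ν_♮(φ) = ∑_{m-2j ≥ 0} (-1)^j φ_{m-2j} ∘ {[1 - (1-τ)s'D̂b] (b̂'D̂b)^j N̂}`. -/
def νNat (m : ℕ) : C.CTNat m →ₗ[kᵐᵒᵖ] C.Cl m :=
  (∑ j ∈ Finset.range (m / 2 + 1), (-1 : ℤ) ^ j •
    (C.νComp m j ∘ₗ DirectSum.component kᵐᵒᵖ ℕ (fun n => C.CT n) (m - 2 * j))) ∘ₗ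
    (C.CTNat m).subtype

/-- The map `ν_♯`, `ν_♯(φ) = class of (φₙ ∘ {[1 - (1-τ)s'D̂b] N̂})ₙ mod ran (1 - S)`. -/
def νSharp : C.CTTot →ₗ[kᵐᵒᵖ] SLim C.S :=
  SLim.mk C.S ∘ₗ DirectSum.toModule kᵐᵒᵖ ℕ _ fun n => C.inl n ∘ₗ C.νComp n 0

end Rat

end HUnitalParaPrecyclicModule

/-! Everything happens in the ring of operators on `⨁ C_T^n`. On this module `T` acts as the
identity, so the relations that hold on chains only modulo `1 - T` become exact, and the whole
argument turns into noncommutative algebra with `e = 1 - τ`, `H = N̂`, `D = D̂`, `c = b̂'`, `s = s'`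
(`CyclicRelations`, verified in `cyclicRelations`). Put `B = N s e`, `W = b D c` and `ρ = 1 - b D s
e`. Here `H` is a projection onto the cyclic cochains, on which `H W` acts as `-S`, and `ν_♮` is the
top component of `H G`, where `G = ∑ (-W)^j ρ` stands for `(1 + W)⁻¹ ρ`.

Compatibility with differentials rests on `ρ b = W B + b H ρ` (`ρ_b`), `ρ B = B` (`ρ_B`) and the
fact that `W` commutes with `b H` (`W_b_H`). Together they give, formally, `G (b + B) = b H G + B`
(`geom_differential`). The summand `B` lowers the degree, so it does not reach the top component,
and `ν_♮` is a cochain map.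

For the homotopy put `α = D s e` and `κ = w + D c`. The identities `homotopy_ρ` and `homotopy_W`
compute `α (b + B) + (b + B) α + κ B = 1 - H ρ` and `(b + B) κ + κ b H = H (1 + W)`. Since `(1 + W)
G = ρ`, the operator `-α - κ G` would formally contract the whole complex. Truncating `G x` strictly
below the top degree before applying `κ` leaves exactly the top component of `H G x` uncancelled,
which is `ι_♮ ν_♮ x` (`homotopyOp_spec`). The series is finite in each degree because `W` raises the
degree by two (`trunc_WOp_pow`).

In the periodic setting, a cyclic cocycle `φ` placed in `C_{T,♮}^{n+2}` has `ν_♮ φ = S φ`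
(`νNat_two`), so `S φ` and `φ` are cohomologous and the map of Connes is well defined on the limit.
A periodic cocycle is finitely supported, hence lies in some `C_{T,♮}^n`, where `ν_♮` makes it
cyclic: the map is onto (`connesMap_surjective`). Modulo `1 - S`, the identity `H ρ b = H W B + b H
ρ` says that `ν_♯` is a cochain map, and `ν_♯` fixes cyclic cochains, so its composite with the map
of Connes is the canonical map. The latter is bijective because direct limits are exact
(`canMap_injective`, `canMap_surjective`). Hence the map of Connes is injective too, and `ν_♯` is
bijective in cohomology. -/

/-- Elements of a ring that satisfy the relations of the operators of the cyclic bicomplex, acting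
on cochains: `e = 1 - τ`, `H = N̂`, `c = b̂'`, `s = s'`, and `w` is the normalization of `s' N`. -/
structure CyclicRelations {E : Type*} [Ring E] (e N H D b b' c s w : E) : Prop where
  e_b : e * b = b' * e
  e_N : e * N = 0
  e_H : e * H = 0
  H_add_De : H + D * e = 1
  H_add_eD : H + e * D = 1
  b_H : b * H = N * c
  c_N : c * N = b' * H
  s_b' : s * b' + b' * s = 1
  s_s : s * s = 0
  b_b : b * b = 0
  b'_c : b' * c = 0
  w_N : w * N = N * s * H
  b_w : b * w = H * b' * s
  N_s_c : N * s * c = H * s * b'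
  e_w : e * w = 0

/-! ### Identities between operators in an abstract ring. -/

namespace CyclicRelations

variable {E : Type*} [Ring E] {e N H D b b' c s w : E} (r : CyclicRelations e N H D b b' c s w)
include r

lemma H_N : H * N = N := by
  linear_combination (norm := noncomm_ring) r.H_add_De * N - D * r.e_N

/-- Moving `b` leftwards gives `D s e b = D s b' e = D e - D b' s e`, hence `ρ b = b H + b D b' s
e`. Inserting `1 = H + e D` after `b'` splits the last term: `b' H = c N` produces `W B`, and `b' e
= e b` with `b D e b = -b H b` produces the rest. -/
lemma ρ_b : (1 - b * D * s * e) * b =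
    b * D * c * (N * s * e) + b * H * (1 - b * D * s * e) := by
  linear_combination (norm := noncomm_ring) -b * D * s * r.e_b - b * D * r.s_b' * e
    - b * r.H_add_De - b * D * r.c_N * s * e - b * D * b' * r.H_add_eD * s * e
    - b * D * r.e_b * D * s * e + b * r.H_add_De * b * D * s * e + r.b_b * D * s * e

lemma ρ_B : (1 - b * D * s * e) * (N * s * e) = N * s * e := by
  linear_combination (norm := noncomm_ring) -b * D * s * r.e_N * s * e

/-- The same rewriting as for `ρ_b`, starting from `b H = N c`; the leftover term dies by `b' c =
0`. -/
lemma W_b_H : b * D * c * (b * H) = b * H * (b * D * c) := by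
  linear_combination (norm := noncomm_ring) b * D * c * r.b_H + b * D * r.c_N * c
    + b * D * b' * r.H_add_eD * c + b * D * r.b'_c + b * D * r.e_b * D * c
    - b * r.H_add_De * b * D * c - r.b_b * D * c

/-- This encodes that `b` preserves cyclic cochains: `b H = N c` has values in the range of `N`,
which `H` fixes. -/
lemma H_b_H : H * b * H = b * H := by
  linear_combination (norm := noncomm_ring) H * r.b_H + r.H_N * c - r.b_H

/-- The role of `w` is to cancel `B D s e = N s (1 - H) s e = -w B`, which uses `s s = 0` and `N s H
= w N`. The summand `D c` cancels the term `-D b' s e` that comes from `D s e b`. -/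
lemma homotopy_ρ : D * s * e * (b + N * s * e) + (b + N * s * e) * (D * s * e)
    + (w + D * c) * (N * s * e) = 1 - H * (1 - b * D * s * e) := by
  linear_combination (norm := noncomm_ring) D * s * r.e_b + D * r.s_b' * e + r.H_add_De
    + D * s * r.e_N * s * e + r.w_N * s * e + N * s * r.H_add_eD * s * e + N * r.s_s * e
    + D * r.c_N * s * e + D * b' * r.H_add_eD * s * e + D * r.e_b * D * s * e
    - r.H_add_De * b * D * s * e

/-- The two halves of `H = H (b' s + s b')` come from `b w = H b' s` and from `w b H = w N c = N s H
c`, whose main part is `N s c = H s b'`. The correction `-B D c` cancels against `B κ`, and `D c b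
H` reduces to `-(1 - H) W`. -/
lemma homotopy_W : (b + N * s * e) * (w + D * c) + (w + D * c) * (b * H) =
    H + H * (b * D * c) := by
  linear_combination (norm := noncomm_ring) r.b_w + N * s * r.e_w + w * r.b_H + r.w_N * c
    + N * s * r.H_add_eD * c + r.N_s_c + H * r.s_b' + D * c * r.b_H + D * r.c_N * c
    + D * b' * r.H_add_eD * c + D * r.b'_c + D * r.e_b * D * c - r.H_add_De * b * D * c

end CyclicRelations

namespace CyclicRelations

variable {E : Type*} [Ring E] {e N H D b b' c s w : E}

/-- The sum of `(-W)^j ρ` over `j < J`, where `W` and `ρ` are the transposes of `b̂' D̂ b` and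
`1 - (1 - τ) s' D̂ b`. -/
def geom (e D b c s : E) (J : ℕ) : E :=
  (∑ j ∈ Finset.range J, (-(b * D * c)) ^ j) * (1 - b * D * s * e)

lemma one_add_W_geom (J : ℕ) : (1 + b * D * c) * geom e D b c s J =
    (1 - b * D * s * e) - (-(b * D * c)) ^ J * (1 - b * D * s * e) := by
  have h := mul_neg_geom_sum (-(b * D * c)) J
  rw [sub_neg_eq_add] at h
  rw [geom, ← mul_assoc, h, sub_mul, one_mul]

/-- By `ρ_b` and `ρ_B`, `ρ (b + B) = (1 + W) B + b H ρ`. The geometric sum telescopes against `1 +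
W` and commutes with `b H`. -/
lemma geom_differential (r : CyclicRelations e N H D b b' c s w) (J : ℕ) :
    geom e D b c s J * (b + N * s * e) = b * H * geom e D b c s J + N * s * e
      - (-(b * D * c)) ^ J * (N * s * e) := by
  have h1 : Commute (b * H) (∑ j ∈ Finset.range J, (-(b * D * c)) ^ j) :=
    Commute.sum_right _ _ _ fun j _ => Commute.pow_right (Commute.neg_right r.W_b_H.symm) j
  have h2 := geom_sum_mul_neg (-(b * D * c)) J
  unfold geom
  generalize ∑ j ∈ Finset.range J, (-(b * D * c)) ^ j = G at *
  generalize (-(b * D * c)) ^ J = Z at *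
  linear_combination (norm := noncomm_ring) G * r.ρ_b + G * r.ρ_B + h2 * (N * s * e)
    - h1.eq * (1 - b * D * s * e)

end CyclicRelations

/-! ### The concrete operators on `⨁ C_T^n` and their relations. -/

namespace HUnitalParaPrecyclicModule

variable {k : Type u} [Ring k] (C : HUnitalParaPrecyclicModule.{u, v} k)

lemma s_s_b'_s (m : ℕ) (x : C.X m) : C.s (m + 1) (C.b' (m + 1) (C.s (m + 1) (C.s m x))) =
    C.s (m + 1) (C.s m x) - C.s (m + 1) (C.s m (C.b' m (C.s m x))) := by
  rw [← map_sub]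
  exact congrArg _ (eq_sub_of_add_eq (LinearMap.congr_fun (C.b'_s m) (C.s m x)))

/-- `s' s' = 0` -/
lemma s'_s' (m : ℕ) (x : C.X m) : C.s' (m + 1) (C.s' m x) = 0 := by
  -- The operator `b' s` is idempotent: it is `1 - s b'` in positive degrees, with `b' b' = 0`, and
  -- it is `1` in degree `0`.
  have key : C.b' m (C.s m (C.b' m (C.s m x))) = C.b' m (C.s m x) := by
    rcases m with _ | m
    · exact LinearMap.congr_fun C.b'_s_zero _
    · have h := congrArg (C.b' (m + 1)) (LinearMap.congr_fun (C.b'_s (m + 1))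
        (C.s (m + 1) x))
      simp only [LinearMap.add_apply, LinearMap.comp_apply, LinearMap.id_apply, map_add,
        C.b'_b', zero_add] at h
      exact h
  simp only [s', LinearMap.comp_apply]
  rw [C.s_s_b'_s, key, sub_self]

/-! ### Operators on `⨁ C_T^n` -/

section Operators

/-- Transposition of an operator that commutes with `T`. -/
def trT {m n : ℕ} (f : C.X m →ₗ[k] C.X n) (h : ∀ x, C.T n (f x) = f (C.T m x)) :
    C.CT n →ₗ[kᵐᵒᵖ] C.CT m :=
  (dual f).restrict fun φ hφ => C.mem_CT.mpr fun x => by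
    change φ (f (C.T m x)) = φ (f x)
    rw [← h, C.mem_CT.mp hφ]

lemma CT_ext {n : ℕ} {φ ψ : C.CT n} (h : ∀ x, φ.1 x = ψ.1 x) : φ = ψ :=
  Subtype.ext (DFunLike.ext _ _ h)

lemma CT_sub_T {n : ℕ} (φ : C.CT n) (x : C.X n) : φ.1 (x - C.T n x) = 0 := by
  rw [map_sub, C.mem_CT.mp φ.2, sub_self]

/-- The ring of operators on `⨁ C_T^n`. -/
instance instRingEndCTTot : Ring (Module.End kᵐᵒᵖ C.CTTot) := Module.End.instRing

/-- The operator of degree `0` on `⨁ C_T^n` with given transpose. -/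
def level (f : ∀ n, C.X n →ₗ[k] C.X n) (h : ∀ n x, C.T n (f n x) = f n (C.T n x)) :
    Module.End kᵐᵒᵖ C.CTTot :=
  DirectSum.toModule kᵐᵒᵖ ℕ _ fun n => C.inT n ∘ₗ C.trT (f n) (h n)

/-- The operator of degree `1` on `⨁ C_T^n` with given transpose. -/
def up (f : ∀ n, C.X (n + 1) →ₗ[k] C.X n) (h : ∀ n x, C.T n (f n x) = f n (C.T (n + 1) x)) :
    Module.End kᵐᵒᵖ C.CTTot :=
  DirectSum.toModule kᵐᵒᵖ ℕ _ fun n => C.inT (n + 1) ∘ₗ C.trT (f n) (h n)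

/-- The components of `down`. -/
def downComp (f : ∀ n, C.X n →ₗ[k] C.X (n + 1))
    (h : ∀ n x, C.T (n + 1) (f n x) = f n (C.T n x)) : ∀ n, C.CT n →ₗ[kᵐᵒᵖ] C.CTTot
  | 0 => 0
  | n + 1 => C.inT n ∘ₗ C.trT (f n) (h n)

/-- The operator of degree `-1` on `⨁ C_T^n` with given transpose. -/
def down (f : ∀ n, C.X n →ₗ[k] C.X (n + 1))
    (h : ∀ n x, C.T (n + 1) (f n x) = f n (C.T n x)) : Module.End kᵐᵒᵖ C.CTTot :=
  DirectSum.toModule kᵐᵒᵖ ℕ _ (C.downComp f h)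

variable {C}

lemma level_inT (f : ∀ n, C.X n →ₗ[k] C.X n) (h : ∀ n x, C.T n (f n x) = f n (C.T n x)) (n : ℕ)
    (φ : C.CT n) : C.level f h (C.inT n φ) = C.inT n (C.trT (f n) (h n) φ) :=
  DirectSum.toModule_lof _ _ _

lemma up_inT (f : ∀ n, C.X (n + 1) →ₗ[k] C.X n)
    (h : ∀ n x, C.T n (f n x) = f n (C.T (n + 1) x)) (n : ℕ)
    (φ : C.CT n) : C.up f h (C.inT n φ) = C.inT (n + 1) (C.trT (f n) (h n) φ) :=
  DirectSum.toModule_lof _ _ _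

lemma down_inT_zero (f : ∀ n, C.X n →ₗ[k] C.X (n + 1))
    (h : ∀ n x, C.T (n + 1) (f n x) = f n (C.T n x)) (φ : C.CT 0) :
    C.down f h (C.inT 0 φ) = 0 :=
  DirectSum.toModule_lof _ _ _

lemma down_inT_succ (f : ∀ n, C.X n →ₗ[k] C.X (n + 1))
    (h : ∀ n x, C.T (n + 1) (f n x) = f n (C.T n x)) (n : ℕ) (φ : C.CT (n + 1)) :
    C.down f h (C.inT (n + 1) φ) = C.inT n (C.trT (f n) (h n) φ) :=
  DirectSum.toModule_lof _ _ _

lemma end_ext {f g : Module.End kᵐᵒᵖ C.CTTot} (h : ∀ n φ, f (C.inT n φ) = g (C.inT n φ)) :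
    f = g :=
  DirectSum.linearMap_ext _ fun n => LinearMap.ext fun φ => h n φ

end Operators

/-- Transposition is contravariant, so here and below a product of operators is the transpose of the
composite in the opposite order. -/
def eOp : Module.End kᵐᵒᵖ C.CTTot := C.level (fun n => LinearMap.id - C.τ n) fun n x => by
  simp only [LinearMap.sub_apply, LinearMap.id_apply, map_sub, C.T_τ]

def NOp : Module.End kᵐᵒᵖ C.CTTot := C.level (fun n => C.N n) fun n x => C.T_N n x

def bOp : Module.End kᵐᵒᵖ C.CTTot := C.up (fun n => C.b n) fun n x => C.T_b n x

def b'Op : Module.End kᵐᵒᵖ C.CTTot := C.up (fun n => C.b' n) fun n x => C.T_b' n x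

def sOp : Module.End kᵐᵒᵖ C.CTTot := C.down (fun n => C.s' n) fun n x => C.T_s' n x

variable {C}

lemma eOp_inT (n : ℕ) (φ : C.CT n) : C.eOp (C.inT n φ) =
    C.inT n (C.trT (LinearMap.id - C.τ n) (fun x => by
      simp only [LinearMap.sub_apply, LinearMap.id_apply, map_sub, C.T_τ]) φ) := level_inT _ _ _ _

lemma NOp_inT (n : ℕ) (φ : C.CT n) :
    C.NOp (C.inT n φ) = C.inT n (C.trT (C.N n) (C.T_N n) φ) := level_inT _ _ _ _

lemma bOp_inT (n : ℕ) (φ : C.CT n) :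
    C.bOp (C.inT n φ) = C.inT (n + 1) (C.trT (C.b n) (C.T_b n) φ) := up_inT _ _ _ _

lemma b'Op_inT (n : ℕ) (φ : C.CT n) :
    C.b'Op (C.inT n φ) = C.inT (n + 1) (C.trT (C.b' n) (C.T_b' n) φ) := up_inT _ _ _ _

lemma sOp_inT_zero (φ : C.CT 0) : C.sOp (C.inT 0 φ) = 0 := down_inT_zero _ _ _

lemma sOp_inT_succ (n : ℕ) (φ : C.CT (n + 1)) :
    C.sOp (C.inT (n + 1) φ) = C.inT n (C.trT (C.s' n) (C.T_s' n) φ) := down_inT_succ _ _ _ _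

variable (C)

section Rat

variable [Algebra ℚ k]

/-- The normalization `x ↦ s' N ((m+2)⁻¹ x)` of `s' N` on `C_m`. -/
def shat (m : ℕ) : C.X m →ₗ[k] C.X (m + 1) := C.rat ((m + 2 : ℚ)⁻¹) (m + 1) ∘ₗ C.s' m ∘ₗ C.N m

lemma T_Nhat (m : ℕ) (x : C.X m) : C.T m (C.Nhat m x) = C.Nhat m (C.T m x) := by
  simp only [ParaPrecyclicModule.Nhat, LinearMap.comp_apply, C.T_N, C.rat_map]

lemma T_bhat' (m : ℕ) (x : C.X (m + 1)) : C.T m (C.bhat' m x) = C.bhat' m (C.T (m + 1) x) := by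
  simp only [ParaPrecyclicModule.bhat', LinearMap.comp_apply, C.rat_map, C.T_b']

lemma T_shat (m : ℕ) (x : C.X m) : C.T (m + 1) (C.shat m x) = C.shat m (C.T m x) := by
  simp only [shat, LinearMap.comp_apply, C.rat_map, C.T_s', C.T_N]

def HOp : Module.End kᵐᵒᵖ C.CTTot := C.level (fun n => C.Nhat n) C.T_Nhat

def DOp : Module.End kᵐᵒᵖ C.CTTot := C.level (fun n => C.Dhat n) fun n x => C.T_Dhat n x

def cOp : Module.End kᵐᵒᵖ C.CTTot := C.up (fun n => C.bhat' n) C.T_bhat'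

def wOp : Module.End kᵐᵒᵖ C.CTTot := C.down (fun n => C.shat n) C.T_shat

variable {C}

lemma HOp_inT (n : ℕ) (φ : C.CT n) :
    C.HOp (C.inT n φ) = C.inT n (C.trT (C.Nhat n) (C.T_Nhat n) φ) := level_inT _ _ _ _

lemma DOp_inT (n : ℕ) (φ : C.CT n) :
    C.DOp (C.inT n φ) = C.inT n (C.trT (C.Dhat n) (C.T_Dhat n) φ) := level_inT _ _ _ _

lemma cOp_inT (n : ℕ) (φ : C.CT n) :
    C.cOp (C.inT n φ) = C.inT (n + 1) (C.trT (C.bhat' n) (C.T_bhat' n) φ) := up_inT _ _ _ _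

lemma wOp_inT_zero (φ : C.CT 0) : C.wOp (C.inT 0 φ) = 0 := down_inT_zero _ _ _

lemma wOp_inT_succ (n : ℕ) (φ : C.CT (n + 1)) :
    C.wOp (C.inT (n + 1) φ) = C.inT n (C.trT (C.shat n) (C.T_shat n) φ) := down_inT_succ _ _ _ _

variable (C)

/-- The relations `e N = e H = e w = 0` need the restriction to `T`-invariant cochains, because on
chains `N (1 - τ) = 1 - T`. The other relations already hold on chains. Those with denominators
compare `1/(n+1)` in degree `n` with the factor of the neighbouring degree, and this is what
dictates the normalizations of `c` and `w`. -/
lemma cyclicRelations : CyclicRelations C.eOp C.NOp C.HOp C.DOp C.bOp C.b'Op C.cOp C.sOp C.wOp where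
  e_b := end_ext fun n φ => by
    simp only [Module.End.mul_apply, eOp_inT, bOp_inT, b'Op_inT]
    refine congrArg _ (C.CT_ext fun x => congrArg φ.1 ?_)
    simpa using C.b_τ n x
  e_N := end_ext fun n φ => by
    simp only [Module.End.mul_apply, eOp_inT, NOp_inT, LinearMap.zero_apply]
    refine (congrArg _ (C.CT_ext fun x => ?_)).trans (map_zero _)
    exact (congrArg φ.1 (C.N_τ n x)).trans (C.CT_sub_T φ x)
  e_H := end_ext fun n φ => by
    simp only [Module.End.mul_apply, eOp_inT, HOp_inT, LinearMap.zero_apply]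
    refine (congrArg _ (C.CT_ext fun x => ?_)).trans (map_zero _)
    refine (congrArg φ.1 ?_).trans (C.CT_sub_T φ (C.rat ((n + 1 : ℚ)⁻¹) n x))
    change C.N n (C.rat _ n (x - C.τ n x)) = _
    rw [map_sub, ← C.rat_map (C.τ n), C.N_τ]
  H_add_De := end_ext fun n φ => by
    simp only [Module.End.mul_apply, LinearMap.add_apply, eOp_inT, HOp_inT, DOp_inT, Module.End.one_apply, ← map_add]
    refine congrArg _ (C.CT_ext fun x => ?_)
    refine (map_add φ.1 _ _).symm.trans (congrArg φ.1 ?_)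
    exact C.Nhat_add n x
  H_add_eD := end_ext fun n φ => by
    simp only [Module.End.mul_apply, LinearMap.add_apply, eOp_inT, HOp_inT, DOp_inT, Module.End.one_apply, ← map_add]
    refine congrArg _ (C.CT_ext fun x => ?_)
    refine (map_add φ.1 _ _).symm.trans (congrArg φ.1 ?_)
    refine Eq.trans (congrArg _ ?_) (C.Nhat_add n x)
    change C.Dhat n (x - C.τ n x) = _
    rw [map_sub, C.τ_Dhat]
  b_H := end_ext fun n φ => by
    simp only [Module.End.mul_apply, NOp_inT, HOp_inT, bOp_inT, cOp_inT]
    refine congrArg _ (C.CT_ext fun x => congrArg φ.1 ?_)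
    change C.N n (C.rat _ n (C.b n x)) = C.rat _ n (C.b' n (C.N (n + 1) x))
    rw [C.rat_map, C.N_b]
  c_N := end_ext fun n φ => by
    simp only [Module.End.mul_apply, NOp_inT, HOp_inT, b'Op_inT, cOp_inT]
    exact congrArg _ (C.CT_ext fun x => rfl)
  s_b' := end_ext fun n φ => by
    rcases n with _ | n
    · simp only [Module.End.mul_apply, LinearMap.add_apply, b'Op_inT, sOp_inT_zero, sOp_inT_succ, map_zero, add_zero, Module.End.one_apply]
      exact congrArg _ (C.CT_ext fun x => congrArg φ.1 (C.b'_s'_zero x))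
    · simp only [Module.End.mul_apply, LinearMap.add_apply, b'Op_inT, sOp_inT_succ, Module.End.one_apply, ← map_add]
      refine congrArg _ (C.CT_ext fun x => ?_)
      exact (map_add φ.1 _ _).symm.trans (congrArg φ.1 (C.b'_s'_add n x))
  s_s := end_ext fun n φ => by
    rcases n with _ | _ | n
    · simp only [Module.End.mul_apply, sOp_inT_zero, map_zero, LinearMap.zero_apply]
    · simp only [Module.End.mul_apply, sOp_inT_succ, sOp_inT_zero, LinearMap.zero_apply]
    · simp only [Module.End.mul_apply, sOp_inT_succ, LinearMap.zero_apply]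
      refine (congrArg _ (C.CT_ext fun x => ?_)).trans (map_zero _)
      exact (congrArg φ.1 (C.s'_s' n x)).trans (map_zero φ.1)
  b_b := end_ext fun n φ => by
    simp only [Module.End.mul_apply, bOp_inT, LinearMap.zero_apply]
    refine (congrArg _ (C.CT_ext fun x => ?_)).trans (map_zero _)
    exact (congrArg φ.1 (C.b_b n x)).trans (map_zero φ.1)
  b'_c := end_ext fun n φ => by
    simp only [Module.End.mul_apply, b'Op_inT, cOp_inT, LinearMap.zero_apply]
    refine (congrArg _ (C.CT_ext fun x => ?_)).trans (map_zero _)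
    refine (congrArg φ.1 ?_).trans (map_zero φ.1)
    change C.rat _ n (C.b' n (C.b' (n + 1) x)) = 0
    rw [C.b'_b', map_zero]
  w_N := end_ext fun n φ => by
    rcases n with _ | n
    · simp only [Module.End.mul_apply, NOp_inT, HOp_inT, sOp_inT_zero, wOp_inT_zero, map_zero]
    · simp only [Module.End.mul_apply, NOp_inT, HOp_inT, sOp_inT_succ, wOp_inT_succ]
      refine congrArg _ (C.CT_ext fun x => congrArg φ.1 ?_)
      change C.N (n + 1) (C.rat _ _ (C.s' n (C.N n x))) = C.N (n + 1) (C.rat _ _ (C.s' n (C.N n x)))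
      push_cast
      ring_nf
  b_w := end_ext fun n φ => by
    rcases n with _ | n
    · simp only [Module.End.mul_apply, sOp_inT_zero, wOp_inT_zero, map_zero]
    · simp only [Module.End.mul_apply, HOp_inT, sOp_inT_succ, wOp_inT_succ, bOp_inT, b'Op_inT]
      refine congrArg _ (C.CT_ext fun x => congrArg φ.1 ?_)
      change C.rat _ _ (C.s' n (C.N n (C.b n x))) = C.s' n (C.b' n (C.N (n + 1) (C.rat _ _ x)))
      rw [C.N_b]
      simp only [C.rat_map]
      push_cast
      ring_nf
  N_s_c := end_ext fun n φ => by
    simp only [Module.End.mul_apply, NOp_inT, HOp_inT, sOp_inT_succ, b'Op_inT, cOp_inT]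
    refine congrArg _ (C.CT_ext fun x => congrArg φ.1 ?_)
    change C.rat _ _ (C.b' n (C.s' n (C.N n x))) = C.b' n (C.s' n (C.N n (C.rat _ _ x)))
    simp only [C.rat_map]
  e_w := end_ext fun n φ => by
    rcases n with _ | n
    · simp only [Module.End.mul_apply, wOp_inT_zero, map_zero, LinearMap.zero_apply]
    · simp only [Module.End.mul_apply, eOp_inT, wOp_inT_succ, LinearMap.zero_apply]
      refine (congrArg _ (C.CT_ext fun x => ?_)).trans (map_zero _)
      have h : C.shat n (x - C.τ n x) = C.rat ((n + 2 : ℚ)⁻¹) _ (C.s' n x) -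
          C.T _ (C.rat ((n + 2 : ℚ)⁻¹) _ (C.s' n x)) := by
        rw [C.rat_map, C.T_s', shat, LinearMap.comp_apply, LinearMap.comp_apply, C.N_τ, map_sub,
          map_sub]
      exact (congrArg φ.1 h).trans (C.CT_sub_T φ _)

end Rat

end HUnitalParaPrecyclicModule

/-! ### Components, truncations and parity. -/

namespace HUnitalParaPrecyclicModule

variable {k : Type u} [Ring k] (C : HUnitalParaPrecyclicModule.{u, v} k)

section Components

variable {C}

lemma level_apply (f : ∀ n, C.X n →ₗ[k] C.X n) (h : ∀ n x, C.T n (f n x) = f n (C.T n x))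
    (x : C.CTTot) (n : ℕ) : C.level f h x n = C.trT (f n) (h n) (x n) := by
  induction x using DirectSum.induction_on with
  | zero => simp
  | add x y hx hy => rw [map_add, DirectSum.add_apply, DirectSum.add_apply, map_add, hx, hy]
  | of l a =>
    change C.level f h (C.inT l a) n = C.trT (f n) (h n) (C.inT l a n)
    rw [level_inT]
    obtain rfl | hn := eq_or_ne n l
    · simp only [DirectSum.lof_eq_of, DirectSum.of_eq_same]
    · simp only [DirectSum.lof_eq_of, DirectSum.of_eq_of_ne _ _ _ hn, map_zero]

lemma up_apply_zero (f : ∀ n, C.X (n + 1) →ₗ[k] C.X n)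
    (h : ∀ n x, C.T n (f n x) = f n (C.T (n + 1) x)) (x : C.CTTot) : C.up f h x 0 = 0 := by
  induction x using DirectSum.induction_on with
  | zero => simp
  | add x y hx hy => rw [map_add, DirectSum.add_apply, hx, hy, add_zero]
  | of l a =>
    change C.up f h (C.inT l a) 0 = 0
    rw [up_inT, DirectSum.lof_eq_of, DirectSum.of_eq_of_ne _ _ _ (Nat.succ_ne_zero l).symm]

lemma up_apply_succ (f : ∀ n, C.X (n + 1) →ₗ[k] C.X n)
    (h : ∀ n x, C.T n (f n x) = f n (C.T (n + 1) x)) (x : C.CTTot) (n : ℕ) :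
    C.up f h x (n + 1) = C.trT (f n) (h n) (x n) := by
  induction x using DirectSum.induction_on with
  | zero => simp
  | add x y hx hy => rw [map_add, DirectSum.add_apply, DirectSum.add_apply, map_add, hx, hy]
  | of l a =>
    change C.up f h (C.inT l a) (n + 1) = C.trT (f n) (h n) (C.inT l a n)
    rw [up_inT]
    obtain rfl | hn := eq_or_ne n l
    · simp only [DirectSum.lof_eq_of, DirectSum.of_eq_same]
    · simp only [DirectSum.lof_eq_of, DirectSum.of_eq_of_ne _ _ _ hn, map_zero,
        DirectSum.of_eq_of_ne _ _ _ (fun h => hn (Nat.succ_injective h) : n + 1 ≠ l + 1)]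

lemma down_apply (f : ∀ n, C.X n →ₗ[k] C.X (n + 1))
    (h : ∀ n x, C.T (n + 1) (f n x) = f n (C.T n x)) (x : C.CTTot) (n : ℕ) :
    C.down f h x n = C.trT (f n) (h n) (x (n + 1)) := by
  induction x using DirectSum.induction_on with
  | zero => simp
  | add x y hx hy => rw [map_add, DirectSum.add_apply, DirectSum.add_apply, map_add, hx, hy]
  | of l a =>
    change C.down f h (C.inT l a) n = C.trT (f n) (h n) (C.inT l a (n + 1))
    rcases l with _ | l
    · rw [down_inT_zero, DirectSum.lof_eq_of, DirectSum.of_eq_of_ne _ _ _ (Nat.succ_ne_zero n),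
        map_zero, DirectSum.zero_apply]
    rw [down_inT_succ]
    obtain rfl | hn := eq_or_ne n l
    · simp only [DirectSum.lof_eq_of, DirectSum.of_eq_same]
    · simp only [DirectSum.lof_eq_of, DirectSum.of_eq_of_ne _ _ _ hn, map_zero,
        DirectSum.of_eq_of_ne _ _ _ (fun h => hn (Nat.succ_injective h) : n + 1 ≠ l + 1)]

end Components

/-- The projection of `⨁ C_T^n` onto the degrees `n < m`. -/
def trunc (m : ℕ) : Module.End kᵐᵒᵖ C.CTTot :=
  DirectSum.toModule kᵐᵒᵖ ℕ _ fun n => if n < m then C.inT n else 0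

variable {C}

lemma trunc_apply (m : ℕ) (x : C.CTTot) (n : ℕ) :
    C.trunc m x n = if n < m then x n else 0 := by
  induction x using DirectSum.induction_on with
  | zero => simp
  | add x y hx hy =>
    rw [map_add, DirectSum.add_apply, DirectSum.add_apply, hx, hy]
    split_ifs <;> simp
  | of l a =>
    change C.trunc m (C.inT l a) n = _
    rw [trunc, DirectSum.toModule_lof, ← DirectSum.lof_eq_of kᵐᵒᵖ]
    obtain rfl | hn := eq_or_ne n l
    · split_ifs <;> simp
    · rw [show C.inT l a n = 0 by rw [DirectSum.lof_eq_of, DirectSum.of_eq_of_ne _ _ _ hn]]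
      split_ifs <;> simp [DirectSum.of_eq_of_ne _ _ _ hn, DirectSum.lof_eq_of]

lemma trunc_zero : C.trunc 0 = 0 := LinearMap.ext fun x => by
  ext n : 1
  rw [trunc_apply, if_neg (Nat.not_lt_zero n)]; rfl

lemma trunc_trunc {l m : ℕ} (h : l ≤ m) : C.trunc l * C.trunc m = C.trunc l :=
  LinearMap.ext fun x => by
    ext n : 1
    rw [Module.End.mul_apply, trunc_apply, trunc_apply, trunc_apply]
    split_ifs <;> first | rfl | omega

lemma trunc_trunc' {l m : ℕ} (h : l ≤ m) : C.trunc m * C.trunc l = C.trunc l :=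
  LinearMap.ext fun x => by
    ext n : 1
    rw [Module.End.mul_apply, trunc_apply, trunc_apply]
    split_ifs <;> first | rfl | omega

lemma trunc_level (m : ℕ) (f : ∀ n, C.X n →ₗ[k] C.X n)
    (h : ∀ n x, C.T n (f n x) = f n (C.T n x)) :
    C.trunc m * C.level f h = C.level f h * C.trunc m := LinearMap.ext fun x => by
  ext n : 1
  rw [Module.End.mul_apply, Module.End.mul_apply, trunc_apply, level_apply, level_apply,
    trunc_apply]
  split_ifs <;> simp

/-- For `m = 0` the default `0 - 1 = 0` is harmless, since both sides vanish. -/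
lemma trunc_up (m : ℕ) (f : ∀ n, C.X (n + 1) →ₗ[k] C.X n)
    (h : ∀ n x, C.T n (f n x) = f n (C.T (n + 1) x)) :
    C.trunc m * C.up f h = C.up f h * C.trunc (m - 1) := LinearMap.ext fun x => by
  ext n : 1
  rw [Module.End.mul_apply, Module.End.mul_apply, trunc_apply]
  rcases n with _ | n
  · rw [up_apply_zero, up_apply_zero, ite_self]
  · rw [up_apply_succ, up_apply_succ, trunc_apply]
    split_ifs <;> first | omega | simp

lemma trunc_down (m : ℕ) (f : ∀ n, C.X n →ₗ[k] C.X (n + 1))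
    (h : ∀ n x, C.T (n + 1) (f n x) = f n (C.T n x)) :
    C.trunc m * C.down f h = C.down f h * C.trunc (m + 1) := LinearMap.ext fun x => by
  ext n : 1
  rw [Module.End.mul_apply, Module.End.mul_apply, trunc_apply, down_apply, down_apply,
    trunc_apply]
  split_ifs <;> first | omega | simp

lemma level_parity (f : ∀ n, C.X n →ₗ[k] C.X n) (h : ∀ n x, C.T n (f n x) = f n (C.T n x))
    {i : ZMod 2} {x : C.CTTot} (hx : x ∈ parity kᵐᵒᵖ (fun n => C.CT n) i) :
    C.level f h x ∈ parity kᵐᵒᵖ (fun n => C.CT n) i := fun n hn => by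
  rw [level_apply, hx n hn, map_zero]

lemma up_parity (f : ∀ n, C.X (n + 1) →ₗ[k] C.X n)
    (h : ∀ n x, C.T n (f n x) = f n (C.T (n + 1) x))
    {i : ZMod 2} {x : C.CTTot} (hx : x ∈ parity kᵐᵒᵖ (fun n => C.CT n) i) :
    C.up f h x ∈ parity kᵐᵒᵖ (fun n => C.CT n) (i + 1) := fun n hn => by
  rcases n with _ | n
  · rw [up_apply_zero]
  · rw [up_apply_succ, hx n (fun h => hn (by rw [← h]; push_cast; rfl)), map_zero]

lemma down_parity (f : ∀ n, C.X n →ₗ[k] C.X (n + 1))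
    (h : ∀ n x, C.T (n + 1) (f n x) = f n (C.T n x))
    {i : ZMod 2} {x : C.CTTot} (hx : x ∈ parity kᵐᵒᵖ (fun n => C.CT n) i) :
    C.down f h x ∈ parity kᵐᵒᵖ (fun n => C.CT n) (i + 1) := fun n hn => by
  rw [down_apply, hx (n + 1) (fun h => hn ?_), map_zero]
  rw [← h]; push_cast
  rw [add_assoc]; exact (add_eq_left.mpr (by decide)).symm

/-- Parity and truncation can be followed separately through products of homogeneous operators,
which is how membership in `C_{T,♮}^m` is checked for the homotopy. -/
lemma mem_CTNat_iff (m : ℕ) (x : C.CTTot) :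
    x ∈ C.CTNat m ↔ x ∈ parity kᵐᵒᵖ (fun n => C.CT n) (m : ZMod 2) ∧ C.trunc (m + 1) x = x := by
  constructor
  · intro h
    refine ⟨fun n hn => h n ?_, ?_⟩
    · rintro ⟨j, rfl⟩
      refine hn ?_
      push_cast
      rw [show (2 : ZMod 2) = 0 from rfl, zero_mul, add_zero]
    · ext n : 1
      rw [trunc_apply]
      split_ifs with hn
      · rfl
      · exact (h n (by rintro ⟨j, rfl⟩; omega)).symm
  · rintro ⟨h1, h2⟩ n hn
    by_cases hm : (n : ZMod 2) = m
    · rw [← h2, trunc_apply, if_neg]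
      intro hlt
      have h := (ZMod.natCast_eq_natCast_iff' n m 2).mp hm
      exact hn ⟨(m - n) / 2, by omega⟩
    · exact h1 n hm

end HUnitalParaPrecyclicModule

/-! ### The geometric series and the homotopy for the mixed complex. -/

namespace HUnitalParaPrecyclicModule

variable {k : Type u} [Ring k] (C : HUnitalParaPrecyclicModule.{u, v} k)

/-- The operator `B` on `⨁ C_T^n`. -/
def BOp : Module.End kᵐᵒᵖ C.CTTot := C.NOp * C.sOp * C.eOp

variable {C}

lemma trunc_bOp (m : ℕ) : C.trunc m * C.bOp = C.bOp * C.trunc (m - 1) := trunc_up _ _ _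

lemma trunc_BOp (m : ℕ) : C.trunc m * C.BOp = C.BOp * C.trunc (m + 1) := by
  have hN : C.trunc m * C.NOp = C.NOp * C.trunc m := trunc_level _ _ _
  have hs : C.trunc m * C.sOp = C.sOp * C.trunc (m + 1) := trunc_down _ _ _
  have he : C.trunc (m + 1) * C.eOp = C.eOp * C.trunc (m + 1) := trunc_level _ _ _
  rw [BOp, ← mul_assoc, ← mul_assoc, hN, mul_assoc C.NOp, hs, mul_assoc, mul_assoc, he, mul_assoc,
    mul_assoc]

lemma bOp_parity {i : ZMod 2} {x : C.CTTot} (hx : x ∈ parity kᵐᵒᵖ (fun n => C.CT n) i) :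
    C.bOp x ∈ parity kᵐᵒᵖ (fun n => C.CT n) (i + 1) := up_parity _ _ hx

lemma trunc_parity (m : ℕ) {i : ZMod 2} {x : C.CTTot}
    (hx : x ∈ parity kᵐᵒᵖ (fun n => C.CT n) i) :
    C.trunc m x ∈ parity kᵐᵒᵖ (fun n => C.CT n) i := fun n hn => by
  rw [trunc_apply, hx n hn, ite_self]

/-- Degree `m - 1` has the wrong parity, so `m` is the only degree that contributes between the two
truncations. -/
lemma trunc_succ_of_parity (m : ℕ) {x : C.CTTot}
    (hx : x ∈ parity kᵐᵒᵖ (fun n => C.CT n) (m : ZMod 2)) :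
    C.trunc (m + 1) x = C.trunc (m - 1) x + C.inT m (x m) := by
  ext n : 1
  rw [DirectSum.add_apply, trunc_apply, trunc_apply, DirectSum.lof_eq_of]
  obtain rfl | hn := eq_or_ne n m
  · rw [DirectSum.of_eq_same, if_pos (Nat.lt_succ_self n), if_neg (by omega), zero_add]
  · rw [DirectSum.of_eq_of_ne _ _ _ hn, add_zero]
    split_ifs with h1 h2 h2
    · rfl
    · refine hx n fun h => ?_
      have h' := (ZMod.natCast_eq_natCast_iff' n m 2).mp h
      omega
    · omega
    · rfl

lemma add_one_add_one_zmod_two (i : ZMod 2) : i + 1 + 1 = i := by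
  rw [add_assoc]; exact add_eq_left.mpr (by decide)

lemma D_eq : C.D = C.bOp + C.BOp := end_ext fun n φ => by
  simp only [LinearMap.add_apply, BOp, Module.End.mul_apply, eOp_inT, bOp_inT]
  rcases n with _ | n
  · rw [sOp_inT_zero, map_zero, add_zero, D_inT_zero]; rfl
  · rw [sOp_inT_succ, NOp_inT, D_inT_succ]; rfl

variable (C)

section Rat

variable [Algebra ℚ k]

/-- The transpose of `b̂' D̂ b` on `⨁ C_T^n`. -/
def WOp : Module.End kᵐᵒᵖ C.CTTot := C.bOp * C.DOp * C.cOp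

/-- The transpose of `1 - (1 - τ) s' D̂ b` on `⨁ C_T^n`. -/
def ρOp : Module.End kᵐᵒᵖ C.CTTot := 1 - C.bOp * C.DOp * C.sOp * C.eOp

/-- The sum of `(-W)^j ρ` over `j < J`. -/
def geomOp (J : ℕ) : Module.End kᵐᵒᵖ C.CTTot :=
  CyclicRelations.geom C.eOp C.DOp C.bOp C.cOp C.sOp J

/-- The transpose of `(1 - τ) s' D̂` on `⨁ C_T^n`. -/
def αOp : Module.End kᵐᵒᵖ C.CTTot := C.DOp * C.sOp * C.eOp

/-- The part of the homotopy that is composed with `geomOp`. -/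
def κOp : Module.End kᵐᵒᵖ C.CTTot := C.wOp + C.DOp * C.cOp

/-- The homotopy from `ι_♮ ν_♮` to the identity of `C_{T,♮}^m`, for `C_{T,♮}^{m+1} → C_{T,♮}^m`. -/
def homotopyOp (m : ℕ) : Module.End kᵐᵒᵖ C.CTTot :=
  -C.αOp - C.κOp * C.trunc m * C.geomOp (m / 2 + 1)

variable {C}

lemma geomOp_eq (J : ℕ) : C.geomOp J = (∑ j ∈ Finset.range J, (-C.WOp) ^ j) * C.ρOp := rfl

lemma one_add_W_geomOp (J : ℕ) :
    (1 + C.WOp) * C.geomOp J = C.ρOp - (-C.WOp) ^ J * C.ρOp :=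
  CyclicRelations.one_add_W_geom (E := Module.End kᵐᵒᵖ C.CTTot) J

lemma geomOp_D (J : ℕ) : C.geomOp J * C.D =
    C.bOp * C.HOp * C.geomOp J + C.BOp - (-C.WOp) ^ J * C.BOp := by
  rw [D_eq]; exact C.cyclicRelations.geom_differential J

lemma ρOp_bOp : C.ρOp * C.bOp = C.WOp * C.BOp + C.bOp * C.HOp * C.ρOp :=
  C.cyclicRelations.ρ_b

lemma ρOp_BOp : C.ρOp * C.BOp = C.BOp := C.cyclicRelations.ρ_B

lemma HOp_bOp_HOp : C.HOp * C.bOp * C.HOp = C.bOp * C.HOp := C.cyclicRelations.H_b_H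

lemma αOp_D : C.αOp * C.D + C.D * C.αOp + C.κOp * C.BOp = 1 - C.HOp * C.ρOp := by
  rw [D_eq]; exact C.cyclicRelations.homotopy_ρ

lemma D_κOp : C.D * C.κOp + C.κOp * (C.bOp * C.HOp) = C.HOp + C.HOp * C.WOp := by
  rw [D_eq]; exact C.cyclicRelations.homotopy_W

lemma trunc_WOp (m : ℕ) : C.trunc m * C.WOp = C.WOp * C.trunc (m - 2) := by
  have hb := fun m => trunc_up m (fun n => C.b n) (fun n x => C.T_b n x)
  have hc := fun m => trunc_up m (fun n => C.bhat' n) C.T_bhat'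
  have hD := fun m => trunc_level m (fun n => C.Dhat n) (fun n x => C.T_Dhat n x)
  change C.trunc m * (C.bOp * C.DOp * C.cOp) = C.bOp * C.DOp * C.cOp * C.trunc (m - 2)
  change ∀ m, C.trunc m * C.bOp = C.bOp * C.trunc (m - 1) at hb
  change ∀ m, C.trunc m * C.cOp = C.cOp * C.trunc (m - 1) at hc
  change ∀ m, C.trunc m * C.DOp = C.DOp * C.trunc m at hD
  rw [← mul_assoc, ← mul_assoc, hb, mul_assoc C.bOp, hD, mul_assoc, mul_assoc, hc, mul_assoc,
    mul_assoc]
  rfl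

lemma trunc_HOp (m : ℕ) : C.trunc m * C.HOp = C.HOp * C.trunc m := trunc_level _ _ _

lemma trunc_αOp (m : ℕ) : C.trunc m * C.αOp = C.αOp * C.trunc (m + 1) := by
  have hD : C.trunc m * C.DOp = C.DOp * C.trunc m := trunc_level _ _ _
  have hs : C.trunc m * C.sOp = C.sOp * C.trunc (m + 1) := trunc_down _ _ _
  have he : C.trunc (m + 1) * C.eOp = C.eOp * C.trunc (m + 1) := trunc_level _ _ _
  rw [αOp, ← mul_assoc, ← mul_assoc, hD, mul_assoc C.DOp, hs, mul_assoc, mul_assoc, he, mul_assoc,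
    mul_assoc]

lemma trunc_κOp (m : ℕ) : C.trunc (m + 1) * (C.κOp * C.trunc m) = C.κOp * C.trunc m := by
  have hD : C.trunc (m + 1) * C.DOp = C.DOp * C.trunc (m + 1) := trunc_level _ _ _
  have hw : C.trunc (m + 1) * C.wOp = C.wOp * C.trunc (m + 2) := trunc_down _ _ _
  have hc : C.trunc (m + 1) * C.cOp = C.cOp * C.trunc m := trunc_up _ _ _
  rw [κOp, add_mul, mul_add, mul_assoc C.DOp, ← mul_assoc _ C.wOp, hw, mul_assoc,
    trunc_trunc' (by omega), ← mul_assoc _ C.DOp, hD, mul_assoc, ← mul_assoc _ C.cOp, hc, mul_assoc,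
    trunc_trunc le_rfl]

lemma trunc_ρOp (m : ℕ) : C.trunc m * C.ρOp = C.ρOp * C.trunc m := by
  have h : C.ρOp = 1 - C.bOp * C.αOp := by simp only [ρOp, αOp, mul_assoc]
  rw [h, mul_sub, sub_mul, mul_one, one_mul, ← mul_assoc, trunc_bOp, mul_assoc, trunc_αOp,
    mul_assoc]
  -- Degree `0` is separate because `0 - 1 + 1 ≠ 0` in `ℕ`; there both sides vanish, as the operator
  -- `α` lowers degrees.
  rcases m with _ | m
  · rw [trunc_zero, mul_zero, mul_zero]
    have : C.αOp * C.trunc 1 = C.trunc 0 * C.αOp := (trunc_αOp 0).symm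
    rw [Nat.zero_sub, zero_add, this, trunc_zero, zero_mul, mul_zero]
  · rfl

/-- Since `W` has degree two, `W ^ J` takes values in degrees at least `2 J`, while the truncation
keeps only degrees below `m`. -/
lemma trunc_WOp_pow {m J : ℕ} (h : m ≤ 2 * J) : C.trunc m * (-C.WOp) ^ J = 0 := by
  induction J generalizing m with
  | zero =>
    obtain rfl : m = 0 := by omega
    rw [trunc_zero, zero_mul]
  | succ J ih =>
    rw [pow_succ', ← mul_assoc, mul_neg, trunc_WOp, neg_mul, mul_assoc, ih (by omega), mul_zero,
      neg_zero]

/-- The number of summands is immaterial below degree `2 J`; this allows one length of the series to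
be used in consecutive degrees. -/
lemma trunc_geomOp {m J J' : ℕ} (h : m ≤ 2 * J) (h' : J ≤ J') :
    C.trunc m * C.geomOp J' = C.trunc m * C.geomOp J := by
  induction J', h' using Nat.le_induction with
  | base => rfl
  | succ l hl ih =>
    rw [← ih, geomOp_eq, geomOp_eq, Finset.sum_range_succ, add_mul, mul_add, ← mul_assoc _ _ C.ρOp,
      ← mul_assoc _ _ C.ρOp, trunc_WOp_pow (by omega), zero_mul, add_zero]

lemma αOp_parity {i : ZMod 2} {x : C.CTTot} (hx : x ∈ parity kᵐᵒᵖ (fun n => C.CT n) i) :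
    C.αOp x ∈ parity kᵐᵒᵖ (fun n => C.CT n) (i + 1) :=
  level_parity _ _ (down_parity _ _ (level_parity _ _ hx))

lemma κOp_parity {i : ZMod 2} {x : C.CTTot} (hx : x ∈ parity kᵐᵒᵖ (fun n => C.CT n) i) :
    C.κOp x ∈ parity kᵐᵒᵖ (fun n => C.CT n) (i + 1) :=
  add_mem (down_parity _ _ hx) (level_parity _ _ (up_parity _ _ hx))

lemma WOp_parity {i : ZMod 2} {x : C.CTTot} (hx : x ∈ parity kᵐᵒᵖ (fun n => C.CT n) i) :
    C.WOp x ∈ parity kᵐᵒᵖ (fun n => C.CT n) i :=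
  add_one_add_one_zmod_two i ▸ bOp_parity (level_parity _ _ (up_parity _ _ hx))

lemma ρOp_parity {i : ZMod 2} {x : C.CTTot} (hx : x ∈ parity kᵐᵒᵖ (fun n => C.CT n) i) :
    C.ρOp x ∈ parity kᵐᵒᵖ (fun n => C.CT n) i :=
  sub_mem hx (add_one_add_one_zmod_two i ▸ bOp_parity (αOp_parity hx))

lemma geomOp_parity {i : ZMod 2} {x : C.CTTot} (hx : x ∈ parity kᵐᵒᵖ (fun n => C.CT n) i) (J : ℕ) :
    C.geomOp J x ∈ parity kᵐᵒᵖ (fun n => C.CT n) i := by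
  rw [geomOp_eq, Module.End.mul_apply, LinearMap.sum_apply]
  refine Submodule.sum_mem _ fun j hj => ?_
  clear hj
  induction j with
  | zero => exact ρOp_parity hx
  | succ j ih => rw [pow_succ']; exact neg_mem (WOp_parity ih)

/-- The operator `κ` may raise the degree by one, so its argument has to be cut to degrees below
`m`; the term `α` lowers degrees and needs no truncation. -/
lemma homotopyOp_mem (m : ℕ) : ∀ x ∈ C.CTNat (m + 1), C.homotopyOp m x ∈ C.CTNat m := by
  intro x hx
  rw [mem_CTNat_iff] at hx ⊢
  obtain ⟨hp, ht⟩ := hx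
  push_cast at hp
  constructor
  · have hα := αOp_parity hp
    have hκ := κOp_parity (trunc_parity m (geomOp_parity hp (m / 2 + 1)))
    rw [add_one_add_one_zmod_two] at hα hκ
    exact sub_mem (neg_mem hα) hκ
  · have h1 : C.trunc (m + 1) * C.homotopyOp m = -(C.αOp * C.trunc (m + 1 + 1)) -
        C.κOp * C.trunc m * C.geomOp (m / 2 + 1) := by
      rw [homotopyOp, mul_sub, mul_neg, trunc_αOp, ← mul_assoc, trunc_κOp]
    have h2 := LinearMap.congr_fun h1 x
    rw [Module.End.mul_apply, LinearMap.sub_apply, LinearMap.neg_apply, Module.End.mul_apply C.αOp,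
      ht] at h2
    exact h2

/-- `ι_♮ ν_♮ - 1 = (b + B) h + h (b + B)` -/
lemma homotopyOp_spec (m : ℕ) (x : C.CTTot) (hx : x ∈ C.CTNat m) :
    C.D (C.homotopyOp (m - 1) x) + C.homotopyOp m (C.D x) =
      C.inT m ((C.HOp * C.geomOp (m / 2 + 1)) x m) - x := by
  obtain ⟨hp, ht⟩ := (C.mem_CTNat_iff m x).mp hx
  set J := m / 2 + 1 with hJ
  -- An operator identity on all of `⨁ C_T^n`: the two truncations of `G` differ because the
  -- differential shifts degrees, and the last term vanishes on cochains supported in degrees at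
  -- most `m`.
  have key : C.D * C.homotopyOp (m - 1) + C.homotopyOp m * C.D =
      -(1 - C.HOp * C.ρOp) - (C.HOp * (C.trunc (m - 1) * C.geomOp J)
        + C.HOp * (C.trunc (m + 1) * C.WOp * C.geomOp J))
        + C.κOp * C.BOp * (1 - C.trunc (m + 1)) := by
    have h1 : C.trunc (m - 1) * C.geomOp ((m - 1) / 2 + 1) = C.trunc (m - 1) * C.geomOp J :=
      (trunc_geomOp (by omega) (by omega)).symm
    have h2 : C.trunc m * (C.geomOp J * C.D) =
        C.bOp * C.HOp * (C.trunc (m - 1) * C.geomOp J) + C.BOp * C.trunc (m + 1) := by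
      rw [geomOp_D, mul_sub, mul_add, ← mul_assoc _ _ C.BOp, trunc_WOp_pow (by omega), zero_mul,
        sub_zero, trunc_BOp, ← mul_assoc, ← mul_assoc, trunc_bOp, mul_assoc C.bOp, trunc_HOp]
      simp only [mul_assoc]
    have h3 : C.trunc (m + 1) * C.WOp = C.WOp * C.trunc (m - 1) := trunc_WOp _
    rw [h3, homotopyOp, homotopyOp, mul_assoc C.κOp, h1]
    linear_combination (norm := noncomm_ring) -αOp_D (C := C) - C.κOp * h2
      - D_κOp (C := C) * (C.trunc (m - 1) * C.geomOp J)
  have key' := LinearMap.congr_fun key x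
  have hy : C.geomOp J x ∈ parity kᵐᵒᵖ (fun n => C.CT n) (m : ZMod 2) := geomOp_parity hp J
  have e1 := trunc_succ_of_parity m hy
  -- In degrees at most `m` the finite sum is an honest inverse: `(1 + W) G = ρ`. Subtracting the
  -- two truncated terms of `key` from `H ρ x` therefore leaves `H` of the degree `m` component of
  -- `G x`.
  have e2 : C.trunc (m + 1) * ((1 + C.WOp) * C.geomOp J) = C.ρOp * C.trunc (m + 1) := by
    rw [one_add_W_geomOp, mul_sub, ← mul_assoc _ _ C.ρOp, trunc_WOp_pow (by omega), zero_mul,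
      sub_zero, trunc_ρOp]
  have e3 := LinearMap.congr_fun e2 x
  simp only [Module.End.mul_apply, LinearMap.add_apply, LinearMap.sub_apply, LinearMap.neg_apply,
    Module.End.one_apply, map_add, ht, sub_self, map_zero, add_zero] at key' e3 ⊢
  have e4 : C.HOp (C.inT m (C.geomOp J x m)) = C.inT m (C.HOp (C.geomOp J x) m) := by
    rw [HOp_inT]
    exact congrArg _ (level_apply _ _ _ _).symm
  rw [e1] at e3
  rw [key', ← e4, ← e3, map_add, map_add]
  abel

end Rat

end HUnitalParaPrecyclicModule

/-! ### The deformation retraction onto cyclic cochains. -/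

namespace HUnitalParaPrecyclicModule

variable {k : Type u} [Ring k] (C : HUnitalParaPrecyclicModule.{u, v} k)

lemma DNat_ιNat (m : ℕ) : C.DNat m ∘ₗ C.ιNat m = C.ιNat (m + 1) ∘ₗ C.bl m :=
  LinearMap.ext fun φ => Subtype.ext (C.D_incl m φ)

section Rat

variable [Algebra ℚ k] {C}

/-- For `n = 0, 1` the index `n - 2` is the default `0`, and the component found there is composed
with the zero map. -/
lemma WOp_apply (x : C.CTTot) (n : ℕ) :
    C.WOp x n = C.trT (C.bDbTot n) (C.T_bDbTot n) (x (n - 2)) := by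
  rcases n with _ | _ | n
  · exact (up_apply_zero _ _ _).trans (C.CT_ext fun y => (map_zero (x (0 - 2)).1).symm)
  · refine (up_apply_succ _ _ _ _).trans (C.CT_ext fun y => ?_)
    change (C.DOp (C.cOp x) 0).1 _ = (x (1 - 2)).1 0
    rw [show C.DOp (C.cOp x) 0 = 0 from (level_apply _ _ _ _).trans
      ((congrArg _ (up_apply_zero _ _ _)).trans (map_zero _)), map_zero]
    rfl
  · refine (up_apply_succ _ _ _ _).trans (C.CT_ext fun y => ?_)
    have h : C.DOp (C.cOp x) (n + 1) =
        C.trT _ (C.T_Dhat (n + 1)) (C.trT _ (C.T_bhat' n) (x n)) :=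
      (level_apply _ _ _ _).trans (congrArg _ (up_apply_succ _ _ _ _))
    change (C.DOp (C.cOp x) (n + 1)).1 _ = _
    rw [h]
    rfl

lemma WOp_pow_apply (x : C.CTTot) (m j : ℕ) :
    (C.WOp ^ j) x m = C.trT (C.bDbPow m j) (C.T_bDbPow m j) (x (m - 2 * j)) := by
  induction j generalizing x with
  | zero => rfl
  | succ j ih =>
    rw [pow_succ, Module.End.mul_apply, ih, WOp_apply]
    rfl

lemma ρOp_apply (x : C.CTTot) (n : ℕ) : C.ρOp x n = C.trT (C.ρ n) (C.T_ρ n) (x n) := by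
  have h : C.ρOp x = x - C.bOp (C.αOp x) := rfl
  rw [h, DirectSum.sub_apply]
  rcases n with _ | n
  · rw [show C.bOp (C.αOp x) 0 = 0 from up_apply_zero _ _ _, sub_zero]
    rfl
  · have h1 : C.αOp x n = C.trT _ (C.T_Dhat n) (C.trT _ (C.T_s' n) (C.eOp x (n + 1))) :=
      (level_apply _ _ _ _).trans (congrArg _ (down_apply _ _ _ _))
    have h2 : C.bOp (C.αOp x) (n + 1) = C.trT _ (C.T_b n) (C.αOp x n) := up_apply_succ _ _ _ _
    have h3 : ∀ y, (C.eOp x (n + 1)).1 y = (x (n + 1)).1 (y - C.τ (n + 1) y) := fun y => by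
      rw [eOp, level_apply]; rfl
    rw [h2, h1]
    refine C.CT_ext fun y => ?_
    change (x (n + 1)).1 y - (C.eOp x (n + 1)).1 _ = (x (n + 1)).1 (C.ρ (n + 1) y)
    rw [h3, ← map_sub]
    rfl

/-- This identifies the explicit formula for `ν_♮` with an operator, so that the ring identities
apply. The length `m / 2 + 1` counts exactly the `j` with `m - 2 j ≥ 0`. -/
lemma incl_νNat (m : ℕ) (x : C.CTNat m) :
    C.incl m (C.νNat m x) = (C.HOp * C.geomOp (m / 2 + 1)) x.1 m := by
  have hH : ∀ y : C.CTTot, C.HOp y m = C.trT _ (C.T_Nhat m) (y m) := fun y => level_apply _ _ _ _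
  have hsum : ∀ (s : Finset ℕ) (f : ℕ → C.CTTot), (∑ j ∈ s, f j) m = ∑ j ∈ s, f j m :=
    fun s f => map_sum (DirectSum.component kᵐᵒᵖ ℕ (fun n => C.CT n) m) f s
  have h1 : C.νNat m x = ∑ j ∈ Finset.range (m / 2 + 1), (-1 : ℤ) ^ j •
      C.νComp m j (x.1 (m - 2 * j)) := by
    rw [νNat, LinearMap.comp_apply, LinearMap.sum_apply]
    rfl
  rw [h1, map_sum, Module.End.mul_apply, hH, geomOp_eq, Module.End.mul_apply,
    LinearMap.sum_apply, hsum, map_sum]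
  refine Finset.sum_congr rfl fun j _ => ?_
  have h2 : ((-C.WOp) ^ j) (C.ρOp x.1) m = (-1 : ℤ) ^ j • (C.WOp ^ j) (C.ρOp x.1) m := by
    rcases Nat.even_or_odd j with h | h
    · rw [h.neg_pow, h.neg_one_pow, one_smul]
    · rw [h.neg_pow, h.neg_one_pow, neg_smul, one_smul]
      rfl
  rw [h2, map_zsmul, map_zsmul, WOp_pow_apply, ρOp_apply]
  rfl

lemma cyclic_Nhat {m : ℕ} (φ : C.Cl m) (x : C.X m) : φ.1 (C.Nhat m x) = φ.1 x := by
  have h := congrArg φ.1 (C.Nhat_add m x)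
  rwa [map_add, map_sub, C.mem_Cl.mp φ.2, sub_self, add_zero] at h

lemma cyclic_ρ : ∀ {m : ℕ} (φ : C.Cl m) (x : C.X m), φ.1 (C.ρ m x) = φ.1 x
  | 0, _, _ => rfl
  | m + 1, φ, x => by
    change φ.1 (x - (C.s' m _ - C.τ (m + 1) (C.s' m _))) = φ.1 x
    rw [map_sub, map_sub, C.mem_Cl.mp φ.2, sub_self, sub_zero]

lemma νComp_zero_incl (m : ℕ) (φ : C.Cl m) : C.νComp m 0 (C.incl m φ) = φ :=
  Subtype.ext <| DFunLike.ext _ _ fun x => (cyclic_ρ φ _).trans (cyclic_Nhat φ x)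

variable (C)

lemma νNat_ιNat (m : ℕ) : C.νNat m ∘ₗ C.ιNat m = LinearMap.id := LinearMap.ext fun φ => by
  have h1 : C.νNat m (C.ιNat m φ) = ∑ j ∈ Finset.range (m / 2 + 1), (-1 : ℤ) ^ j •
      C.νComp m j (C.inT m (C.incl m φ) (m - 2 * j)) := by
    rw [νNat, LinearMap.comp_apply, LinearMap.sum_apply]
    rfl
  rw [LinearMap.comp_apply, h1, Finset.sum_eq_single 0]
  · rw [pow_zero, one_smul, DirectSum.lof_eq_of]
    refine Eq.trans ?_ (νComp_zero_incl m φ)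
    exact congrArg _ (DirectSum.of_eq_same m _)
  · intro j hj h0
    rw [Finset.mem_range] at hj
    -- The bound on `j` excludes `m = 0`, where truncated subtraction would give `m - 2 j = m`.
    rw [DirectSum.lof_eq_of, DirectSum.of_eq_of_ne _ _ _ (by omega), map_zero, smul_zero]
  · simp

lemma νNat_DNat (m : ℕ) : C.νNat (m + 1) ∘ₗ C.DNat m = C.bl m ∘ₗ C.νNat m :=
  LinearMap.ext fun x => by
    obtain ⟨hp, ht⟩ := (C.mem_CTNat_iff m x).mp x.2
    apply Submodule.inclusion_injective (C.Cl_le_CT (m + 1))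
    refine (incl_νNat (m + 1) (C.DNat m x)).trans ?_
    have hb : C.incl (m + 1) (C.bl m (C.νNat m x)) =
        C.trT _ (C.T_b m) (C.incl m (C.νNat m x)) := rfl
    refine Eq.trans ?_ hb.symm
    rw [incl_νNat]
    set J := (m + 1) / 2 + 1 with hJ
    have h1 : C.HOp * C.geomOp J * C.D = C.bOp * C.HOp * C.geomOp J + C.HOp * C.BOp
        - C.HOp * ((-C.WOp) ^ J * C.BOp) := by
      rw [mul_assoc, geomOp_D, mul_sub, mul_add, ← mul_assoc, ← mul_assoc, HOp_bOp_HOp]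
    have h2 : ∀ y : C.CTTot, C.trunc (m + 2) y (m + 1) = y (m + 1) := fun y => by
      rw [trunc_apply, if_pos (by omega)]
    have h3 : C.trunc (m + 2) * (C.HOp * ((-C.WOp) ^ J * C.BOp)) = 0 := by
      rw [← mul_assoc, trunc_HOp, mul_assoc, ← mul_assoc _ _ C.BOp, trunc_WOp_pow (by omega),
        zero_mul, mul_zero]
    have h3' : ((C.HOp * ((-C.WOp) ^ J * C.BOp)) x.1) (m + 1) = 0 := by
      rw [← h2, ← Module.End.mul_apply, h3]
      rfl
    -- The `B`-term of the commutation relation lives in degrees below `m`, so it does not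
    -- contribute to the component of degree `m + 1`.
    have h4 : C.HOp * C.BOp * C.trunc (m + 1) = C.trunc m * (C.HOp * C.BOp) := by
      rw [← mul_assoc, trunc_HOp, mul_assoc, mul_assoc, trunc_BOp]
    have h4' : ((C.HOp * C.BOp) x.1) (m + 1) = 0 := by
      have := LinearMap.congr_fun h4 x.1
      rw [Module.End.mul_apply, ht] at this
      rw [this, Module.End.mul_apply, trunc_apply, if_neg (by omega)]
    have h5 : C.trunc (m + 1) * (C.HOp * C.geomOp J) =
        C.trunc (m + 1) * (C.HOp * C.geomOp (m / 2 + 1)) := by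
      rw [← mul_assoc, trunc_HOp, mul_assoc, trunc_geomOp (J := m / 2 + 1) (by omega) (by omega),
        ← mul_assoc, ← trunc_HOp, mul_assoc]
    have h5' : ((C.HOp * C.geomOp J) x.1) m = ((C.HOp * C.geomOp (m / 2 + 1)) x.1) m := by
      have := congrArg (fun z : C.CTTot => z m) (LinearMap.congr_fun h5 x.1)
      simpa only [Module.End.mul_apply, trunc_apply, Nat.lt_succ_self, if_true] using this
    have h6 : (C.HOp * C.geomOp J) (C.D x.1) = C.bOp ((C.HOp * C.geomOp J) x.1)
        + (C.HOp * C.BOp) x.1 - (C.HOp * ((-C.WOp) ^ J * C.BOp)) x.1 :=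
      LinearMap.congr_fun h1 x.1
    change ((C.HOp * C.geomOp J) (C.D x.1)) (m + 1) = _
    rw [h6, DirectSum.sub_apply, DirectSum.add_apply, h4', h3', ← h5', add_zero, sub_zero]
    exact up_apply_succ _ _ _ _

/-- The homotopy from `ι_♮ ν_♮` to the identity of `C_{T,♮}`. -/
def homotopyNat (m : ℕ) : C.CTNat (m + 1) →ₗ[kᵐᵒᵖ] C.CTNat m :=
  (C.homotopyOp m).restrict (homotopyOp_mem m)

lemma homotopyNat_spec (m : ℕ) (φ : C.CTNat (m + 1)) :
    C.ιNat (m + 1) (C.νNat (m + 1) φ) - φ =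
      C.DNat m (C.homotopyNat m φ) + C.homotopyNat (m + 1) (C.DNat (m + 1) φ) :=
  Subtype.ext <| by
    refine Eq.trans ?_ (homotopyOp_spec (m + 1) φ.1 φ.2).symm
    change C.inT (m + 1) (C.incl (m + 1) (C.νNat (m + 1) φ)) - φ.1 = _
    rw [incl_νNat]

lemma homotopyNat_spec_zero (φ : C.CTNat 0) :
    C.ιNat 0 (C.νNat 0 φ) - φ = C.homotopyNat 0 (C.DNat 0 φ) := Subtype.ext <| by
  -- In degree `0` the general formula still contains a term `(b + B) h` with the default `0 - 1 =
  -- 0`; it vanishes because `α` lowers degrees and the truncated term is zero.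
  have h0 : C.homotopyOp 0 φ.1 = 0 := by
    have h1 : C.αOp * C.trunc 1 = C.trunc 0 * C.αOp := (trunc_αOp 0).symm
    have h2 := LinearMap.congr_fun h1 φ.1
    rw [trunc_zero, zero_mul, Module.End.mul_apply,
      ((C.mem_CTNat_iff 0 φ.1).mp φ.2).2] at h2
    rw [homotopyOp, trunc_zero, mul_zero, zero_mul, sub_zero]
    exact neg_eq_zero.mpr h2
  have h := homotopyOp_spec 0 φ.1 φ.2
  rw [Nat.zero_sub, h0, map_zero, zero_add] at h
  refine Eq.trans ?_ h.symm
  change C.inT 0 (C.incl 0 (C.νNat 0 φ)) - φ.1 = _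
  rw [incl_νNat]

lemma νNat_cocycle (m : ℕ) (φ : C.CTNat m) (h : C.DNat m φ = 0) : C.bl m (C.νNat m φ) = 0 := by
  have h1 := LinearMap.congr_fun (C.νNat_DNat m) φ
  rw [LinearMap.comp_apply, h, map_zero] at h1
  exact h1.symm

lemma ιNat_νNat_sub_mem (m : ℕ) (φ : C.CTNat m) (h : C.DNat m φ = 0) :
    C.ιNat m (C.νNat m φ) - φ ∈ C.coboundariesNat m := by
  rcases m with _ | m
  · rw [C.homotopyNat_spec_zero, h, map_zero]
    exact zero_mem _
  · rw [C.homotopyNat_spec, h, map_zero, add_zero]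
    exact ⟨_, rfl⟩

end Rat

end HUnitalParaPrecyclicModule

/-! ### Homogeneous representatives in periodic direct limits. -/

section PeriodicLimit

variable {R : Type u} [Ring R] {A : ℕ → Type v} [∀ n, AddCommGroup (A n)] [∀ n, Module R (A n)]
  (S : ∀ n, A n →ₗ[R] A (n + 2))

lemma directSum_exists_bound (x : ⨁ n, A n) : ∃ M, ∀ n, M ≤ n → x n = 0 := by
  classical
  obtain ⟨M, hM⟩ := (DFinsupp.support x).bddAbove
  refine ⟨M + 1, fun n hn => ?_⟩
  by_contra h
  have := hM (Finset.mem_coe.mpr (DFinsupp.mem_support_iff.mpr h))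
  omega

lemma directSum_lof_injective (n : ℕ) : Function.Injective (DirectSum.lof R ℕ A n) :=
  fun a b h => by
    have := congrArg (fun z : ⨁ n, A n => z n) h
    simpa only [DirectSum.lof_apply] using this

lemma directSum_lof_ne {n m : ℕ} (h : m ≠ n) (a : A n) : DirectSum.lof R ℕ A n a m = 0 := by
  rw [DirectSum.lof_eq_of, DirectSum.of_eq_of_ne _ _ _ h]

lemma shift_apply_of_lt (x : ⨁ n, A n) {n : ℕ} (hn : n < 2) : shift S x n = 0 := by
  induction x using DirectSum.induction_on with
  | zero => simp
  | add x y hx hy => rw [map_add, DirectSum.add_apply, hx, hy, add_zero]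
  | of l a =>
    rw [← DirectSum.lof_eq_of R, shift_lof]
    exact directSum_lof_ne (by omega) _

lemma shift_apply_add_two (x : ⨁ n, A n) (n : ℕ) : shift S x (n + 2) = S n (x n) := by
  induction x using DirectSum.induction_on with
  | zero => simp
  | add x y hx hy => rw [map_add, DirectSum.add_apply, DirectSum.add_apply, map_add, hx, hy]
  | of l a =>
    rw [← DirectSum.lof_eq_of R, shift_lof]
    obtain rfl | hn := eq_or_ne n l
    · rw [DirectSum.lof_apply, DirectSum.lof_apply]
    · rw [directSum_lof_ne (by omega), directSum_lof_ne hn, map_zero]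

lemma shift_iterate_apply (l : ℕ) (x : ⨁ n, A n) {n : ℕ} (hn : n < 2 * l) :
    (shift S)^[l] x n = 0 := by
  induction l generalizing n with
  | zero => omega
  | succ l ih =>
    rw [Function.iterate_succ_apply']
    by_cases h : n < 2
    · exact shift_apply_of_lt S _ h
    · obtain ⟨m, rfl⟩ : ∃ m, n = m + 2 := ⟨n - 2, by omega⟩
      rw [shift_apply_add_two, ih (by omega), map_zero]

/-- Iterating on the direct sum and then extracting a homogeneous representative avoids composing
maps between the dependent types `A (n + 2 * j)`. -/
lemma exists_shift_iterate_lof (l : ℕ) {n : ℕ} (a : A n) :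
    ∃ a' : A (n + 2 * l), DirectSum.lof R ℕ A _ a' = (shift S)^[l] (DirectSum.lof R ℕ A n a) := by
  induction l with
  | zero => exact ⟨a, rfl⟩
  | succ l ih =>
    obtain ⟨a', h⟩ := ih
    exact ⟨S _ a', by rw [Function.iterate_succ_apply', ← h, shift_lof]; rfl⟩

lemma sum_shift_iterate (z : ⨁ n, A n) (l : ℕ) :
    ∑ j ∈ Finset.range l, (shift S)^[j] (z - shift S z) = z - (shift S)^[l] z := by
  induction l with
  | zero => simp
  | succ l ih =>
    have h : (shift S)^[l] (z - shift S z) = (shift S)^[l] z - (shift S)^[l + 1] z := by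
      rw [Function.iterate_succ_apply]
      exact iterate_map_sub (shift S) l z _
    rw [Finset.sum_range_succ, ih, h]
    abel

lemma SLim.mk_shift (x : ⨁ n, A n) : SLim.mk S (shift S x) = SLim.mk S x := by
  refine ((Submodule.Quotient.eq _).mpr ?_).symm
  exact ⟨x, rfl⟩

lemma SLim.mk_shift_iterate (l : ℕ) (x : ⨁ n, A n) :
    SLim.mk S ((shift S)^[l] x) = SLim.mk S x := by
  induction l with
  | zero => rfl
  | succ l ih => rw [Function.iterate_succ_apply', SLim.mk_shift, ih]

/-- A homogeneous element vanishes in the direct limit only if a power of `S` annihilates it. -/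
lemma SLim.exists_shift_iterate_eq_zero {n : ℕ} (a : A n)
    (h : SLim.mk S (DirectSum.lof R ℕ A n a) = 0) :
    ∃ l, (shift S)^[l] (DirectSum.lof R ℕ A n a) = 0 := by
  obtain ⟨z, hz⟩ := (Submodule.Quotient.mk_eq_zero _).mp h
  change z - shift S z = DirectSum.lof R ℕ A n a at hz
  obtain ⟨M, hM⟩ := directSum_exists_bound z
  refine ⟨M, ?_⟩
  -- Telescoping turns `a = (1 - S) z` into `∑ S^j a = z - S^(n+M+1) z`. In degree `n + 2 M` the
  -- left side is `S^M a`. On the right, `z` vanishes by the choice of `M`, and the iterate starts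
  -- only in degree `2 (n + M + 1)`.
  have h1 := sum_shift_iterate S z (n + M + 1)
  rw [hz] at h1
  have h2 := congrArg (DirectSum.component R ℕ A (n + 2 * M)) h1
  rw [map_sum, Finset.sum_eq_single M] at h2
  · obtain ⟨a', ha⟩ := exists_shift_iterate_lof S M a
    rw [← ha] at h2 ⊢
    rw [DirectSum.component.lof_self] at h2
    have h3 : (z - (shift S)^[n + M + 1] z) (n + 2 * M) = 0 := by
      rw [DirectSum.sub_apply, hM _ (by omega), shift_iterate_apply S _ _ (by omega), sub_zero]
    rw [h2]
    exact (congrArg _ h3).trans (map_zero _)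
  · intro j _ hj
    obtain ⟨a', ha⟩ := exists_shift_iterate_lof S j a
    rw [← ha]
    exact directSum_lof_ne (R := R) (by omega) _
  · intro hM'
    simp only [Finset.mem_range] at hM'
    omega

lemma natCast_zmod_two_add_two_mul (n l : ℕ) : ((n + 2 * l : ℕ) : ZMod 2) = n := by
  push_cast
  rw [show (2 : ZMod 2) = 0 from rfl, zero_mul, add_zero]

lemma SLim.exists_mk_lof_of_le {n m : ℕ} (hnm : (n : ZMod 2) = m) (hle : n ≤ m) (a : A n) :
    ∃ a' : A m, SLim.mk S (DirectSum.lof R ℕ A m a') = SLim.mk S (DirectSum.lof R ℕ A n a) := by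
  obtain ⟨l, rfl⟩ : ∃ l, m = n + 2 * l :=
    ⟨(m - n) / 2, by have := (ZMod.natCast_eq_natCast_iff' n m 2).mp hnm; omega⟩
  obtain ⟨a', h⟩ := exists_shift_iterate_lof S l a
  exact ⟨a', by rw [h, SLim.mk_shift_iterate]⟩

/-- Every element of the direct limit is the class of a homogeneous element. -/
lemma SLim.exists_mk_lof {i : ZMod 2} {y : SLim S} (hy : y ∈ SLim.gr S i) :
    ∃ (n : ℕ) (_ : (n : ZMod 2) = i) (a : A n), SLim.mk S (DirectSum.lof R ℕ A n a) = y := by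
  let Q : Submodule R (SLim S) :=
    { carrier := {y | ∃ (n : ℕ) (_ : (n : ZMod 2) = i) (a : A n),
        SLim.mk S (DirectSum.lof R ℕ A n a) = y}
      zero_mem' := ⟨i.val, ZMod.natCast_zmod_val i, 0, by rw [map_zero, map_zero]⟩
      add_mem' := by
        rintro _ _ ⟨n, hn, a, rfl⟩ ⟨m, hm, c, rfl⟩
        -- The degree `n + 2 m` has the required parity and dominates both `n` and `m`.
        obtain ⟨a', ha⟩ := SLim.exists_mk_lof_of_le S (m := n + 2 * m)
          (natCast_zmod_two_add_two_mul n m).symm (by omega) a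
        obtain ⟨c', hc⟩ := SLim.exists_mk_lof_of_le S (m := n + 2 * m)
          (by rw [natCast_zmod_two_add_two_mul, hn, hm]) (by omega) c
        exact ⟨n + 2 * m, by rw [natCast_zmod_two_add_two_mul, hn], a' + c', by
          rw [map_add, map_add, ha, hc]⟩
      smul_mem' := by
        rintro r _ ⟨n, hn, a, rfl⟩
        exact ⟨n, hn, r • a, by rw [map_smul, map_smul]⟩ }
  obtain ⟨x, hx, rfl⟩ := hy
  exact parity_induction A Q (SLim.mk S) (fun n hn a => ⟨n, hn, a, rfl⟩) x hx

variable {P : Type*} [AddCommGroup P] [Module R P] {i : ZMod 2}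

/-- The linear map out of a direct limit given by a compatible family of linear maps. -/
def SLim.lift (Φ : ∀ n : ℕ, (n : ZMod 2) = i → A n →ₗ[R] P)
    (hΦ : ∀ n hn hn' a, Φ (n + 2) hn' (S n a) = Φ n hn a) : SLim.gr S i →ₗ[R] P :=
  -- Components of the other parity are sent to `0`; as `S` preserves parity, the range of `1 - S`
  -- is still annihilated.
  Submodule.liftQ _ (DirectSum.toModule R ℕ P fun n => if h : (n : ZMod 2) = i then Φ n h else 0)
    (by
      rintro _ ⟨x, rfl⟩
      rw [LinearMap.mem_ker]
      induction x using DirectSum.induction_on with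
      | zero => rw [map_zero, map_zero]
      | add x y hx hy => rw [map_add, map_add, hx, hy, add_zero]
      | of n a =>
        have h2 : ((n + 2 : ℕ) : ZMod 2) = n := natCast_zmod_two_add_two_mul n 1
        rw [← DirectSum.lof_eq_of R, LinearMap.sub_apply, LinearMap.id_apply, map_sub, shift_lof,
          DirectSum.toModule_lof, DirectSum.toModule_lof]
        by_cases h : (n : ZMod 2) = i
        · rw [dif_pos h, dif_pos (h2.trans h), hΦ n h, sub_self]
        · rw [dif_neg h, dif_neg (fun h' => h (h2.symm.trans h'))]
          exact sub_self _) ∘ₗ (SLim.gr S i).subtype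

lemma SLim.lift_of (Φ : ∀ n : ℕ, (n : ZMod 2) = i → A n →ₗ[R] P)
    (hΦ : ∀ n hn hn' a, Φ (n + 2) hn' (S n a) = Φ n hn a) {n : ℕ} (hn : (n : ZMod 2) = i)
    (a : A n) : SLim.lift S Φ hΦ (SLim.of S hn a) = Φ n hn a := by
  refine (DirectSum.toModule_lof R
    (φ := fun n : ℕ => if h : (n : ZMod 2) = i then Φ n h else 0) n a).trans ?_
  rw [dif_pos hn]

end PeriodicLimit

/-! ### Classes in the cohomology of `ℤ/2`-graded complexes. -/

namespace Z2Complex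

variable {R : Type u} [Ring R] {K L : Z2Complex.{u, v} R} {i : ZMod 2}

lemma cls_eq_zero {x : K.M} {hx : x ∈ K.gr i} {hd : K.d x = 0} :
    K.cls x hx hd = 0 ↔ ∃ y ∈ K.gr (i + 1), K.d y = x :=
  (Submodule.Quotient.mk_eq_zero _).trans Iff.rfl

lemma cls_eq_cls {x x' : K.M} {hx : x ∈ K.gr i} {hd : K.d x = 0} {hx' : x' ∈ K.gr i}
    {hd' : K.d x' = 0} : K.cls x hx hd = K.cls x' hx' hd' ↔ ∃ y ∈ K.gr (i + 1), K.d y = x - x' :=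
  (Submodule.Quotient.eq _).trans Iff.rfl

lemma exists_cls (h : K.H i) : ∃ x hx hd, K.cls (i := i) x hx hd = h := by
  obtain ⟨⟨x, hx, hd⟩, rfl⟩ := Submodule.mkQ_surjective _ h
  exact ⟨x, hx, hd, rfl⟩

/-- The map to cohomology induced by a linear map with values in the cocycles. -/
def clsMap {M : Type*} [AddCommGroup M] [Module R M] (f : M →ₗ[R] K.M) (hf : ∀ z, f z ∈ K.gr i)
    (hd : ∀ z, K.d (f z) = 0) : M →ₗ[R] K.H i :=
  Submodule.mkQ _ ∘ₗ f.codRestrict (K.cocycles i) fun z => ⟨hf z, hd z⟩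

lemma clsMap_eq_zero {M : Type*} [AddCommGroup M] [Module R M] {f : M →ₗ[R] K.M}
    {hf : ∀ z, f z ∈ K.gr i} {hd : ∀ z, K.d (f z) = 0} {z : M} :
    clsMap f hf hd z = 0 ↔ ∃ y ∈ K.gr (i + 1), K.d y = f z :=
  cls_eq_zero (hx := hf z) (hd := hd z)

lemma clsMap_eq_clsMap {M M' : Type*} [AddCommGroup M] [Module R M] [AddCommGroup M'] [Module R M']
    {f : M →ₗ[R] K.M} {hf : ∀ z, f z ∈ K.gr i} {hd : ∀ z, K.d (f z) = 0} {z : M}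
    {f' : M' →ₗ[R] K.M} {hf' : ∀ z, f' z ∈ K.gr i} {hd' : ∀ z, K.d (f' z) = 0} {z' : M'} :
    clsMap f hf hd z = clsMap f' hf' hd' z' ↔ ∃ y ∈ K.gr (i + 1), K.d y = f z - f' z' :=
  cls_eq_cls (hx := hf z) (hd := hd z) (hx' := hf' z') (hd' := hd' z')

end Z2Complex

/-! ### Periodic cyclic cohomology as a direct limit. -/

namespace HUnitalParaPrecyclicModule

variable {k : Type u} [Ring k] (C : HUnitalParaPrecyclicModule.{u, v} k)

variable {C}

lemma inl_injective (n : ℕ) : Function.Injective (C.inl n) :=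
  directSum_lof_injective (R := kᵐᵒᵖ) (A := fun n => C.Cl n) n

lemma incl_injective (n : ℕ) : Function.Injective (C.incl n) :=
  Submodule.inclusion_injective (C.Cl_le_CT n)

lemma inT_injective (n : ℕ) : Function.Injective (C.inT n) :=
  directSum_lof_injective (R := kᵐᵒᵖ) (A := fun n => C.CT n) n

/-- Finite support bounds the degrees. The degree found is a successor, so that coboundaries in it
form the range of the previous differential. -/
lemma exists_mem_CTNat {i : ZMod 2} {x : C.CTTot}
    (hx : x ∈ parity kᵐᵒᵖ (fun n => C.CT n) i) :
    ∃ n : ℕ, ((n + 1 : ℕ) : ZMod 2) = i ∧ x ∈ C.CTNat (n + 1) := by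
  obtain ⟨M, hM⟩ := directSum_exists_bound (A := fun n => C.CT n) x
  obtain ⟨n, hn⟩ : ∃ n : ℕ, ((n + 2 * M + 1 : ℕ) : ZMod 2) = i :=
    ⟨(i + 1).val, by rw [Nat.cast_succ, natCast_zmod_two_add_two_mul, ZMod.natCast_zmod_val,
      add_one_add_one_zmod_two]⟩
  refine ⟨n + 2 * M, hn, ?_⟩
  rw [mem_CTNat_iff, hn]
  refine ⟨hx, ?_⟩
  ext l : 1
  rw [trunc_apply]
  split_ifs with hl
  · rfl
  · exact (hM l (by omega)).symm

lemma natCast_eq_add_one {n : ℕ} {i : ZMod 2} (hn : ((n + 1 : ℕ) : ZMod 2) = i) :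
    (n : ZMod 2) = i + 1 := by
  rw [← hn, Nat.cast_succ, add_one_add_one_zmod_two]

variable (C) in
/-- The class map of cyclic cocycles in `HP^i(C_T)`. -/
def clsHPMap (n : ℕ) (i : ZMod 2) (hn : (n : ZMod 2) = i) : C.Zl n →ₗ[kᵐᵒᵖ] C.HP i :=
  Z2Complex.clsMap (K := C.CTSharp) (C.inT n ∘ₗ C.incl n ∘ₗ (C.Zl n).subtype)
    (fun _ => lof_mem_parity (fun n => C.CT n) hn _) fun φ => by
      refine (C.D_incl n φ.1).trans ?_
      rw [LinearMap.mem_ker.mp φ.2, map_zero, map_zero]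
      rfl

lemma clsHPMap_coboundary (n : ℕ) (i : ZMod 2) (hn : (n : ZMod 2) = i) :
    (C.Bl n).submoduleOf (C.Zl n) ≤ LinearMap.ker (C.clsHPMap n i hn) := by
  rintro ⟨φ, hφ⟩ h
  rcases n with _ | n
  · obtain rfl : φ = 0 := h
    exact zero_mem (LinearMap.ker (C.clsHPMap 0 i hn))
  · refine Z2Complex.clsMap_eq_zero.mpr ?_
    obtain ⟨ψ, rfl⟩ := h
    exact ⟨C.inT n (C.incl n ψ), lof_mem_parity (fun n => C.CT n) (natCast_eq_add_one hn) _,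
      C.D_incl n ψ⟩

lemma BOp_inT_succ (n : ℕ) (φ : C.CT (n + 1)) :
    C.BOp (C.inT (n + 1) φ) = C.inT n (C.BT n φ) := by
  rw [BOp, Module.End.mul_apply, Module.End.mul_apply, eOp_inT, sOp_inT_succ, NOp_inT]
  rfl

lemma BOp_inT_zero (φ : C.CT 0) : C.BOp (C.inT 0 φ) = 0 := by
  rw [BOp, Module.End.mul_apply, Module.End.mul_apply, eOp_inT, sOp_inT_zero, map_zero]

section Rat

variable [Algebra ℚ k]

lemma blTot_shift_iterate (l : ℕ) (x : ⨁ n, C.Cl n) :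
    C.blTot ((shift C.S)^[l] x) = (shift C.S)^[l] (C.blTot x) := by
  induction l with
  | zero => rfl
  | succ l ih =>
    rw [Function.iterate_succ_apply', Function.iterate_succ_apply', blTot_shift, ih]

/-! ### The cochain map `ν_♯` -/

lemma νSharp_inT (n : ℕ) (φ : C.CT n) :
    C.νSharp (C.inT n φ) = SLim.mk C.S (C.inl n (C.νComp n 0 φ)) := by
  rw [νSharp, LinearMap.comp_apply]
  exact congrArg _ (DirectSum.toModule_lof _ _ _)

lemma HOp_ρOp_inT (n : ℕ) (φ : C.CT n) :
    C.HOp (C.ρOp (C.inT n φ)) = C.inT n (C.incl n (C.νComp n 0 φ)) := by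
  have h : C.ρOp (C.inT n φ) = C.inT n (C.trT (C.ρ n) (C.T_ρ n) φ) := by
    ext l : 1
    rw [ρOp_apply]
    obtain rfl | hl := eq_or_ne l n
    · rw [DirectSum.lof_apply, DirectSum.lof_apply]
    · rw [directSum_lof_ne (R := kᵐᵒᵖ) (A := fun n => C.CT n) hl,
        directSum_lof_ne (R := kᵐᵒᵖ) (A := fun n => C.CT n) hl, map_zero]
  rw [h, HOp_inT]
  rfl

/-- The periodicity operator enters the operator calculus here; the sign is that of `S₀ = -b̂' D̂ b
N̂`. -/
lemma HOp_WOp_incl (n : ℕ) (φ : C.Cl n) :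
    C.HOp (C.WOp (C.inT n (C.incl n φ))) = -C.inT (n + 2) (C.incl (n + 2) (C.S n φ)) := by
  rw [WOp, Module.End.mul_apply, Module.End.mul_apply, cOp_inT, DOp_inT, bOp_inT, HOp_inT,
    ← map_neg]
  refine congrArg _ (C.CT_ext fun x => ?_)
  change φ.1 (C.bDb n (C.Nhat (n + 2) x)) = -φ.1 (-C.bDb n (C.Nhat (n + 2) x))
  rw [map_neg, neg_neg]

lemma HOp_ρOp_bOp : C.HOp * C.ρOp * C.bOp =
    C.HOp * C.WOp * C.BOp + C.bOp * (C.HOp * C.ρOp) := by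
  rw [mul_assoc, ρOp_bOp, mul_add, ← mul_assoc, ← mul_assoc, ← mul_assoc, HOp_bOp_HOp,
    mul_assoc C.bOp]

lemma HOp_ρOp_BOp : C.HOp * C.ρOp * C.BOp = C.BOp := by
  rw [mul_assoc, ρOp_BOp, BOp, ← mul_assoc, ← mul_assoc, C.cyclicRelations.H_N]

lemma νComp_bT_zero (φ : C.CT 0) : C.νComp 1 0 (C.bT 0 φ) = C.bl 0 (C.νComp 0 0 φ) := by
  have h := LinearMap.congr_fun (HOp_ρOp_bOp (C := C)) (C.inT 0 φ)
  simp only [Module.End.mul_apply, LinearMap.add_apply, BOp_inT_zero, map_zero, zero_add, bOp_inT,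
    HOp_ρOp_inT] at h
  exact incl_injective _ (inT_injective _ h)

lemma incl_νComp_BT (n : ℕ) (φ : C.CT (n + 1)) :
    C.incl n (C.νComp n 0 (C.BT n φ)) = C.BT n φ := by
  have h := LinearMap.congr_fun (HOp_ρOp_BOp (C := C)) (C.inT (n + 1) φ)
  simp only [Module.End.mul_apply, BOp_inT_succ, HOp_ρOp_inT] at h
  exact inT_injective _ h

/-- This is `H ρ b = H W B + b H ρ` read on one component: `B φ` is already cyclic, so `H W` acts on
it as `-S`. Modulo `1 - S` the error term is cancelled by the contribution of `B φ` to `ν_♯ (b + B)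
φ`. -/
lemma νComp_bT_succ (n : ℕ) (φ : C.CT (n + 1)) : C.νComp (n + 2) 0 (C.bT (n + 1) φ) =
    C.bl (n + 1) (C.νComp (n + 1) 0 φ) - C.S n (C.νComp n 0 (C.BT n φ)) := by
  have h := LinearMap.congr_fun (HOp_ρOp_bOp (C := C)) (C.inT (n + 1) φ)
  simp only [Module.End.mul_apply, LinearMap.add_apply, BOp_inT_succ, bOp_inT,
    HOp_ρOp_inT] at h
  rw [← incl_νComp_BT, HOp_WOp_incl, ← map_neg, ← map_neg, ← map_add] at h
  refine incl_injective _ ((inT_injective _ h).trans ?_)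
  rw [sub_eq_neg_add, map_add]
  rfl

lemma νSharp_D (x : C.CTTot) : C.νSharp (C.D x) = C.ClSharp.d (C.νSharp x) := by
  obtain ⟨d, hd⟩ : ∃ d : SLim C.S →ₗ[kᵐᵒᵖ] SLim C.S, ∀ z, d (SLim.mk C.S z) =
      SLim.mk C.S (C.blTot z) ∧ d = C.ClSharp.d := ⟨C.ClSharp.d, fun z => ⟨rfl, rfl⟩⟩
  have h : C.νSharp ∘ₗ C.D = d ∘ₗ C.νSharp := by
    refine DirectSum.linearMap_ext _ fun n => LinearMap.ext fun φ => ?_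
    change C.νSharp (C.D (C.inT n φ)) = d (C.νSharp (C.inT n φ))
    rw [νSharp_inT, (hd _).1, blTot_inl]
    rcases n with _ | n
    · rw [D_inT_zero, νSharp_inT, νComp_bT_zero]
    · have hs := SLim.mk_shift C.S (C.inl n (C.νComp n 0 (C.BT n φ)))
      rw [shift_lof] at hs
      rw [D_inT_succ, map_add, νSharp_inT, νSharp_inT, νComp_bT_succ, map_sub, map_sub, ← hs]
      exact sub_add_cancel _ _
  rw [← (hd 0).2]
  exact LinearMap.congr_fun h x

variable (C) in
/-- The cochain map `ν_♯ : C_{T,♯} → C_{λ,♯}`. -/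
def νHom : Z2Complex.Hom C.CTSharp C.ClSharp where
  f := C.νSharp
  map_gr i := parity_induction _ _ _ fun n hn φ => by
    change C.νSharp (C.inT n φ) ∈ _
    rw [νSharp_inT]
    exact ⟨_, lof_mem_parity (fun n => C.Cl n) hn _, rfl⟩
  comm := νSharp_D

/-! ### The canonical isomorphism and the map of Connes -/

/-- Only the summand `j = 1` sees the component of degree `n`, and a cyclic cochain is not affected
by `1 - (1 - τ) s' D̂ b`. -/
lemma νNat_two (n : ℕ) (φ : C.Cl n) (h : C.inT n (C.incl n φ) ∈ C.CTNat (n + 2)) :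
    C.νNat (n + 2) ⟨C.inT n (C.incl n φ), h⟩ = C.S n φ := by
  have h1 : C.νNat (n + 2) ⟨C.inT n (C.incl n φ), h⟩ =
      ∑ j ∈ Finset.range ((n + 2) / 2 + 1), (-1 : ℤ) ^ j •
        C.νComp (n + 2) j (C.inT n (C.incl n φ) (n + 2 - 2 * j)) := by
    rw [νNat, LinearMap.comp_apply, LinearMap.sum_apply]
    rfl
  rw [h1, Finset.sum_eq_single 1]
  · have h2 : C.inT n (C.incl n φ) (n + 2 - 2 * 1) = C.incl n φ := DirectSum.lof_apply _ _ _
    rw [h2, pow_one, neg_smul, one_smul]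
    refine Subtype.ext (DFunLike.ext _ _ fun x => ?_)
    change -φ.1 (C.ρ n (C.bDb n (C.Nhat (n + 2) x))) = φ.1 (-C.bDb n (C.Nhat (n + 2) x))
    rw [cyclic_ρ, map_neg]
  · intro j hj h0
    rw [Finset.mem_range] at hj
    rw [directSum_lof_ne (R := kᵐᵒᵖ) (A := fun n => C.CT n) (by omega), map_zero, smul_zero]
  · intro h
    simp only [Finset.mem_range] at h
    omega

variable (C) in
/-- The class map of cyclic cocycles in `H_{λ,♯}^i(C)`. -/
def clsSharpMap (n : ℕ) (i : ZMod 2) (hn : (n : ZMod 2) = i) : C.Zl n →ₗ[kᵐᵒᵖ] C.HlSharp i :=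
  Z2Complex.clsMap (K := C.ClSharp) (SLim.mk C.S ∘ₗ C.inl n ∘ₗ (C.Zl n).subtype)
    (fun _ => ⟨_, lof_mem_parity (fun n => C.Cl n) hn _, rfl⟩) fun φ => by
      change SLim.mk C.S (C.blTot (C.inl n φ.1)) = 0
      rw [blTot_inl, LinearMap.mem_ker.mp φ.2, map_zero, map_zero]

lemma clsSharpMap_coboundary (n : ℕ) (i : ZMod 2) (hn : (n : ZMod 2) = i) :
    (C.Bl n).submoduleOf (C.Zl n) ≤ LinearMap.ker (C.clsSharpMap n i hn) := by
  rintro ⟨φ, hφ⟩ h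
  rcases n with _ | n
  · obtain rfl : φ = 0 := h
    exact zero_mem (LinearMap.ker (C.clsSharpMap 0 i hn))
  · refine Z2Complex.clsMap_eq_zero.mpr ?_
    obtain ⟨ψ, rfl⟩ := h
    refine ⟨SLim.mk C.S (C.inl n ψ),
      ⟨_, lof_mem_parity (fun n => C.Cl n) (natCast_eq_add_one hn) _, rfl⟩, ?_⟩
    change SLim.mk C.S (C.blTot (C.inl n ψ)) = _
    rw [blTot_inl]
    rfl

/-- Regarded in `C_{T,♮}^{n+2}`, the cocycle `φ` is cohomologous to `ι_♮ ν_♮ φ`, which is the image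
of `S φ`. -/
lemma clsHPMap_S (n : ℕ) (i : ZMod 2) (hn : (n : ZMod 2) = i) (hn' : ((n + 2 : ℕ) : ZMod 2) = i)
    (φ : C.Zl n) (h : C.S n φ.1 ∈ C.Zl (n + 2)) :
    C.clsHPMap (n + 2) i hn' ⟨C.S n φ.1, h⟩ = C.clsHPMap n i hn φ := by
  have hm : C.inT n (C.incl n φ.1) ∈ C.CTNat (n + 2) := C.inT_mem_CTNat ⟨1, rfl⟩ _
  have hD : C.DNat (n + 2) ⟨_, hm⟩ = 0 := Subtype.ext ((C.D_incl n φ.1).trans (by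
    rw [LinearMap.mem_ker.mp φ.2, map_zero, map_zero]
    rfl))
  obtain ⟨y, hy⟩ := C.ιNat_νNat_sub_mem (n + 2) ⟨_, hm⟩ hD
  rw [νNat_two] at hy
  refine Z2Complex.clsMap_eq_clsMap.mpr ⟨y.1, ?_, congrArg Subtype.val hy⟩
  have := ((C.mem_CTNat_iff _ _).mp y.2).1
  rwa [natCast_eq_add_one hn'] at this

lemma clsSharpMap_S (n : ℕ) (i : ZMod 2) (hn : (n : ZMod 2) = i)
    (hn' : ((n + 2 : ℕ) : ZMod 2) = i) (φ : C.Zl n) (h : C.S n φ.1 ∈ C.Zl (n + 2)) :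
    C.clsSharpMap (n + 2) i hn' ⟨C.S n φ.1, h⟩ = C.clsSharpMap n i hn φ := by
  refine Z2Complex.clsMap_eq_clsMap.mpr ⟨0, zero_mem _, (map_zero _).trans ?_⟩
  have hs := SLim.mk_shift C.S (C.inl n φ.1)
  rw [shift_lof] at hs
  exact (sub_eq_zero.mpr hs).symm

variable (C) in
/-- The map of Connes `lim_S H_λ^{2q+i}(C) → HP^i(C_T)`. -/
def connesMap (i : ZMod 2) : C.limHl i →ₗ[kᵐᵒᵖ] C.HP i :=
  SLim.lift C.SH (fun n hn => Submodule.liftQ _ (C.clsHPMap n i hn) (clsHPMap_coboundary n i hn))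
    fun n hn hn' a => by
      obtain ⟨φ, rfl⟩ := Submodule.mkQ_surjective _ a
      exact clsHPMap_S n i hn hn' φ _

variable (C) in
/-- The canonical map `lim_S H_λ^{2q+i}(C) → H_{λ,♯}^i(C)`. -/
def canMap (i : ZMod 2) : C.limHl i →ₗ[kᵐᵒᵖ] C.HlSharp i :=
  SLim.lift C.SH
    (fun n hn => Submodule.liftQ _ (C.clsSharpMap n i hn) (clsSharpMap_coboundary n i hn))
    fun n hn hn' a => by
      obtain ⟨φ, rfl⟩ := Submodule.mkQ_surjective _ a
      exact clsSharpMap_S n i hn hn' φ _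

lemma connesMap_clsLim {m : ℕ} {i : ZMod 2} (hm : (m : ZMod 2) = i) (φ : C.Zl m) :
    C.connesMap i (C.clsLim hm φ) = C.clsHP hm φ := SLim.lift_of _ _ _ hm _

lemma canMap_clsLim {m : ℕ} {i : ZMod 2} (hm : (m : ZMod 2) = i) (φ : C.Zl m) :
    C.canMap i (C.clsLim hm φ) = C.clsSharp hm φ := SLim.lift_of _ _ _ hm _

lemma exists_clsLim {i : ZMod 2} (x : C.limHl i) :
    ∃ (m : ℕ) (hm : (m : ZMod 2) = i) (φ : C.Zl m), C.clsLim hm φ = x := by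
  obtain ⟨m, hm, a, h⟩ := SLim.exists_mk_lof C.SH x.2
  obtain ⟨φ, rfl⟩ := Submodule.mkQ_surjective _ a
  exact ⟨m, hm, φ, Subtype.ext h⟩

/-- The identity holds at the level of cochains, because `ν_♯` sends a cyclic cochain to its own
class. -/
lemma mapH_connesMap (i : ZMod 2) (x : C.limHl i) :
    C.νHom.mapH i (C.connesMap i x) = C.canMap i x := by
  obtain ⟨m, hm, φ, rfl⟩ := exists_clsLim x
  rw [connesMap_clsLim, canMap_clsLim]
  refine congrArg (Submodule.mkQ _) (Subtype.ext ?_)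
  change C.νSharp (C.inT m (C.incl m φ.1)) = SLim.mk C.S (C.inl m φ.1)
  rw [νSharp_inT, νComp_zero_incl]

lemma clsLim_S {n : ℕ} {i : ZMod 2} (hn : (n : ZMod 2) = i) (hn' : ((n + 2 : ℕ) : ZMod 2) = i)
    (φ : C.Zl n) (h : C.S n φ.1 ∈ C.Zl (n + 2)) :
    C.clsLim hn' ⟨C.S n φ.1, h⟩ = C.clsLim hn φ := Subtype.ext <| by
  have hs := SLim.mk_shift C.SH (DirectSum.lof kᵐᵒᵖ ℕ C.Hl n (C.clsl n φ))
  rw [shift_lof] at hs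
  exact hs

/-- One representative controls both limits: the limit of cochains, through the iterate of `S`, and
the limit of cohomology classes. -/
lemma exists_clsLim_shift {n : ℕ} {i : ZMod 2} (hn : (n : ZMod 2) = i) (φ : C.Zl n) (l : ℕ)
    (hl : ((n + 2 * l : ℕ) : ZMod 2) = i) :
    ∃ φ' : C.Zl (n + 2 * l), C.inl _ φ'.1 = (shift C.S)^[l] (C.inl n φ.1) ∧
      C.clsLim hl φ' = C.clsLim hn φ := by
  induction l with
  | zero => exact ⟨φ, rfl, rfl⟩
  | succ l ih =>
    obtain ⟨φ', h1, h2⟩ := ih ((natCast_zmod_two_add_two_mul n l).trans hn)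
    have h3 : C.S _ φ'.1 ∈ C.Zl (n + 2 * l + 2) := by
      rw [Zl, LinearMap.mem_ker, ← S_bl, LinearMap.mem_ker.mp φ'.2, map_zero]
    refine ⟨⟨C.S _ φ'.1, h3⟩, ?_, ?_⟩
    · rw [Function.iterate_succ_apply', ← h1, shift_lof]
      rfl
    · exact (clsLim_S _ hl φ' h3).trans h2

lemma exists_clsLim_of_le {n m : ℕ} {i : ZMod 2} (hn : (n : ZMod 2) = i) (hm : (m : ZMod 2) = i)
    (hle : n ≤ m) (φ : C.Zl n) : ∃ φ' : C.Zl m,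
      SLim.mk C.S (C.inl m φ'.1) = SLim.mk C.S (C.inl n φ.1) ∧
        C.clsLim hm φ' = C.clsLim hn φ := by
  obtain ⟨l, rfl⟩ : ∃ l, m = n + 2 * l :=
    ⟨(m - n) / 2, by have := (ZMod.natCast_eq_natCast_iff' n m 2).mp (hn.trans hm.symm); omega⟩
  obtain ⟨φ', h1, h2⟩ := exists_clsLim_shift hn φ l hm
  exact ⟨φ', by rw [h1, SLim.mk_shift_iterate], h2⟩

/-- If `φ` dies in the limit of cochains, then some power of `S` annihilates `φ` itself, and a
fortiori its cohomology class. -/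
lemma clsLim_eq_zero {n : ℕ} {i : ZMod 2} (hn : (n : ZMod 2) = i) (φ : C.Zl n)
    (h : SLim.mk C.S (C.inl n φ.1) = 0) : C.clsLim hn φ = 0 := by
  obtain ⟨l, hl⟩ := SLim.exists_shift_iterate_eq_zero C.S φ.1 h
  obtain ⟨φ', h1, h2⟩ := exists_clsLim_shift hn φ l ((natCast_zmod_two_add_two_mul n l).trans hn)
  rw [hl] at h1
  obtain rfl : φ' = 0 := Subtype.ext (inl_injective _ (h1.trans (map_zero _).symm))
  rw [← h2]
  refine Subtype.ext ?_
  change SLim.mk C.SH (DirectSum.lof kᵐᵒᵖ ℕ C.Hl _ (C.clsl _ 0)) = 0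
  rw [map_zero, map_zero, map_zero]

lemma canMap_injective (i : ZMod 2) : Function.Injective (C.canMap i) := by
  rw [injective_iff_map_eq_zero]
  intro x hx
  obtain ⟨m, hm, φ, rfl⟩ := exists_clsLim x
  rw [canMap_clsLim] at hx
  obtain ⟨y, hy, hyφ⟩ := Z2Complex.cls_eq_zero.mp hx
  obtain ⟨n, hn, c, rfl⟩ := SLim.exists_mk_lof C.S hy
  -- The cocycle and its primitive are pushed to adjacent degrees, `n + 2 m + 1` and `n + 2 m`,
  -- where their difference `φ' - b c'` makes sense; it vanishes in the limit of cochains.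
  have hN : ((n + 2 * m + 1 : ℕ) : ZMod 2) = i := by
    rw [Nat.cast_succ, natCast_zmod_two_add_two_mul, hn, add_one_add_one_zmod_two]
  obtain ⟨φ', hmk, hφ'⟩ := exists_clsLim_of_le hm hN (by omega) φ
  obtain ⟨c', hc'⟩ := SLim.exists_mk_lof_of_le C.S (m := n + 2 * m)
    (natCast_zmod_two_add_two_mul n m).symm (by omega) c
  have hb : C.bl _ c' ∈ C.Zl (n + 2 * m + 1) := by
    rw [Zl, LinearMap.mem_ker, bl_bl]
  have h1 : C.clsLim hN φ' = C.clsLim hN (φ' - ⟨C.bl _ c', hb⟩) := by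
    refine Subtype.ext (congrArg (fun z => SLim.mk C.SH (DirectSum.lof kᵐᵒᵖ ℕ C.Hl _ z)) ?_)
    refine (Submodule.Quotient.eq _).mpr ?_
    rw [sub_sub_cancel]
    exact ⟨c', rfl⟩
  rw [← hφ', h1]
  refine clsLim_eq_zero hN _ ?_
  have h2 : SLim.mk C.S (C.inl _ (C.bl _ c')) = SLim.mk C.S (C.inl m φ.1) := by
    rw [← hyφ, ← blTot_inl]
    exact congrArg C.ClSharp.d hc'
  change SLim.mk C.S (C.inl _ (φ'.1 - C.bl _ c')) = 0
  rw [map_sub, map_sub, h2, hmk, sub_self]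

/-- If `b a` vanishes in the limit, then `b (S^l a) = S^l (b a) = 0` for some `l`, so `S^l a` is a
genuine cyclic cocycle with the same class as `a`. -/
lemma canMap_surjective (i : ZMod 2) : Function.Surjective (C.canMap i) := by
  intro z
  obtain ⟨x, hx, hd, rfl⟩ := Z2Complex.exists_cls z
  obtain ⟨m, hm, a, rfl⟩ := SLim.exists_mk_lof C.S hx
  change SLim.mk C.S (C.blTot (C.inl m a)) = 0 at hd
  rw [blTot_inl] at hd
  obtain ⟨l, hl⟩ := SLim.exists_shift_iterate_eq_zero C.S _ hd
  obtain ⟨a', ha⟩ := exists_shift_iterate_lof C.S l a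
  have h0 : C.bl _ a' = 0 := by
    refine inl_injective _ ?_
    rw [map_zero, ← blTot_inl, ← hl, ← blTot_inl, ← blTot_shift_iterate]
    exact congrArg _ ha
  refine ⟨C.clsLim ((natCast_zmod_two_add_two_mul m l).trans hm) ⟨a', h0⟩, ?_⟩
  rw [canMap_clsLim]
  refine congrArg (Submodule.mkQ _) (Subtype.ext ?_)
  change SLim.mk C.S (C.inl _ a') = SLim.mk C.S (C.inl m a)
  rw [← SLim.mk_shift_iterate C.S l (C.inl m a)]
  exact congrArg _ ha

/-- A periodic cocycle lies in some `C_{T,♮}^{n+1}`, where it is cohomologous to the cyclic cocycle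
given by `ν_♮`. -/
lemma connesMap_surjective (i : ZMod 2) : Function.Surjective (C.connesMap i) := by
  intro z
  obtain ⟨x, hx, hd, rfl⟩ := Z2Complex.exists_cls z
  obtain ⟨n, hn, hxm⟩ := exists_mem_CTNat hx
  have hD : C.DNat _ ⟨x, hxm⟩ = 0 := Subtype.ext hd
  obtain ⟨y, hy⟩ := C.ιNat_νNat_sub_mem _ ⟨x, hxm⟩ hD
  refine ⟨C.clsLim hn ⟨C.νNat _ ⟨x, hxm⟩, C.νNat_cocycle _ _ hD⟩, ?_⟩
  rw [connesMap_clsLim]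
  refine Z2Complex.cls_eq_cls.mpr ⟨y.1, ?_, congrArg Subtype.val hy⟩
  have := ((C.mem_CTNat_iff _ _).mp y.2).1
  rwa [natCast_eq_add_one hn] at this

variable (C) in
/-- The canonical isomorphism `lim_S H_λ^{2q+i}(C) ≃ H_{λ,♯}^i(C)`. -/
noncomputable def canEquiv (i : ZMod 2) : C.limHl i ≃ₗ[kᵐᵒᵖ] C.HlSharp i :=
  LinearEquiv.ofBijective (C.canMap i) ⟨canMap_injective i, canMap_surjective i⟩

lemma connesMap_injective (i : ZMod 2) : Function.Injective (C.connesMap i) := fun x y h =>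
  canMap_injective i <| by rw [← mapH_connesMap, ← mapH_connesMap, h]

variable (C) in
/-- Connes' isomorphism `lim_S H_λ^{2q+i}(C) ≃ HP^i(C_T)`. -/
noncomputable def connesEquiv (i : ZMod 2) : C.limHl i ≃ₗ[kᵐᵒᵖ] C.HP i :=
  LinearEquiv.ofBijective (C.connesMap i) ⟨connesMap_injective i, connesMap_surjective i⟩

/-- In cohomology `ν_♯` is the canonical isomorphism composed with the inverse of that of Connes. -/
lemma νHom_isQuasiIso : C.νHom.IsQuasiIso := fun i => by
  have h : ⇑(C.νHom.mapH i) = C.canEquiv i ∘ (C.connesEquiv i).symm := funext fun y => by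
    obtain ⟨x, rfl⟩ := (C.connesEquiv i).surjective y
    rw [Function.comp_apply, LinearEquiv.symm_apply_apply]
    exact mapH_connesMap i x
  rw [h]
  exact (C.canEquiv i).bijective.comp (C.connesEquiv i).symm.bijective

end Rat

end HUnitalParaPrecyclicModule

theorem mainTheorem12 {k : Type u} [Ring k] [Algebra ℚ k]
    (C : HUnitalParaPrecyclicModule.{u, v} k) :
    -- `ν_♮` is a cochain map, left-inverse and cochain homotopy right-inverse of `ι_♮`
    (∀ m, C.DNat m ∘ₗ C.ιNat m = C.ιNat (m + 1) ∘ₗ C.bl m) ∧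
    (∀ m, C.νNat (m + 1) ∘ₗ C.DNat m = C.bl m ∘ₗ C.νNat m) ∧
    (∀ m, C.νNat m ∘ₗ C.ιNat m = LinearMap.id) ∧
    (∃ h : ∀ m, C.CTNat (m + 1) →ₗ[kᵐᵒᵖ] C.CTNat m,
      (∀ φ, C.ιNat 0 (C.νNat 0 φ) - φ = h 0 (C.DNat 0 φ)) ∧
      ∀ m φ, C.ιNat (m + 1) (C.νNat (m + 1) φ) - φ =
        C.DNat m (h m φ) + h (m + 1) (C.DNat (m + 1) φ)) ∧
    -- `ν_♮` converts a `(b, B)`-cocycle into a cohomologous cyclic cocycle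
    (∀ m (φ : C.CTNat m), C.DNat m φ = 0 →
      C.bl m (C.νNat m φ) = 0 ∧ C.ιNat m (C.νNat m φ) - φ ∈ C.coboundariesNat m) ∧
    -- `ν_♯` is a cochain map and a quasi-isomorphism, the Connes map `ι` is well defined and an
    -- isomorphism, and the triangle `ν_♯ ∘ ι = canonical isomorphism` commutes
    ∃ ν : Z2Complex.Hom C.CTSharp C.ClSharp, ν.f = C.νSharp ∧ ν.IsQuasiIso ∧
      ∀ i : ZMod 2,
        ∃ (can : C.limHl i ≃ₗ[kᵐᵒᵖ] C.HlSharp i) (ι : C.limHl i ≃ₗ[kᵐᵒᵖ] C.HP i),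
          (∀ (m : ℕ) (hm : (m : ZMod 2) = i) (φ : C.Zl m),
            can (C.clsLim hm φ) = C.clsSharp hm φ) ∧
          (∀ (m : ℕ) (hm : (m : ZMod 2) = i) (φ : C.Zl m),
            ι (C.clsLim hm φ) = C.clsHP hm φ) ∧
          (∀ x, ν.mapH i (ι x) = can x) ∧
          (∀ y, ι (can.symm (ν.mapH i y)) = y) := by
  refine ⟨C.DNat_ιNat, C.νNat_DNat, C.νNat_ιNat,
    ⟨C.homotopyNat, C.homotopyNat_spec_zero, C.homotopyNat_spec⟩,
    fun m φ h => ⟨C.νNat_cocycle m φ h, C.ιNat_νNat_sub_mem m φ h⟩,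
    C.νHom, rfl, HUnitalParaPrecyclicModule.νHom_isQuasiIso, fun i =>
    ⟨C.canEquiv i, C.connesEquiv i, fun m hm φ => HUnitalParaPrecyclicModule.canMap_clsLim hm φ,
      fun m hm φ => HUnitalParaPrecyclicModule.connesMap_clsLim hm φ,
      HUnitalParaPrecyclicModule.mapH_connesMap i, fun y => ?_⟩⟩
  obtain ⟨x, rfl⟩ := (C.connesEquiv i).surjective y
  have h : C.νHom.mapH i (C.connesEquiv i x) = C.canEquiv i x :=
    HUnitalParaPrecyclicModule.mapH_connesMap i x
  rw [h, LinearEquiv.symm_apply_apply]
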